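/- **Setup.** Let $\tilde B$ be an $(n+m)\times n$ integer matrix with skew-symmetric principal part, let $\mathcal F=\mathbb C(x_1,\dots,x_{n+m})$, and consider all seeds obtained by iterated mutation at the mutable indices $1,\dots,n$ from the seed $((x_1,\dots,x_{n+m}),\tilde B)$. Here the mutation at $k$ replaces $z_k$ by $z_k^{-1}\bigl(\prod_{b_{ik}>0}z_i^{b_{ik}}+\prod_{b_{ik}<0}z_i^{-b_{ik}}\bigr)$ and applies matrix mutation to $\tilde B$. - The cluster algebra $A\subset\mathcal F$ is generated over $\mathbb C[x_{n+1}^{\pm1},\dots,x_{n+m}^{\pm1}]$ by the cluster variables $z_1,\dots,z_n$ of all seeds. The upper cluster algebra is $U=\bigcap_{(\mathbf z,\tilde B')}\mathbb C[z_1^{\pm1},\dots,z_{n+m}^{\pm1}]$, the intersection running over all seeds. Let $\mathcal A=\operatorname{Spec}A$ and $\mathcal U=\operatorname{Spec}U$; a point means a $\mathbb C$-point. Every seed $t$ gives a cluster torus $T(t)=\operatorname{Spec}\mathbb C[z_1^{\pm1},\dots,z_{n+m}^{\pm1}]$ in $\mathcal A$ and in $\mathcal U$. - $\operatorname{Aut}(A)$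 is the group of $\mathbb C$-algebra automorphisms of $A$ that multiply each cluster variable and each frozen variable $x_{n+1},\dots,x_{n+m}$ by a nonzero scalar. These automorphisms extend uniquely to $\mathcal F$, and the extensions preserve $U$, so $\operatorname{Aut}(A)$ acts on $\mathcal A$ and on $\mathcal U$. - For $\mathcal X\in\{\mathcal A,\mathcal U\}$, the deep locus is $\mathcal D(\mathcal X)=\mathcal X\setminus\bigcup_tT(t)$, and the stabilizer locus $\mathcal S(\mathcal X)$ is the set of points with nontrivial stabilizer in $\operatorname{Aut}(A)$. A mysterious point is an element of $\mathcal D(\mathcal X)\setminus\mathcal S(\mathcal X)$, and $A$ (respectively $U$) has no mysterious points if $\mathcal S(\mathcal X)=\mathcal D(\mathcal X)$ for $\mathcal X=\mathcal A$ (respectively $\mathcal X=\mathcal U$). Let $$B=\begin{pmatrix}0&-2&2\\2&0&-2\\-2&2&0\end{pmatrix},\qquad \tilde B_{\mathrm{prin}}=\begin{pmatrix}B\\ I_3\end{pmatrix}.$$ **Proposition.** 1. The Markov cluster algebra with principal coefficients $A_{\mathrm{prin}}=A(\tilde B_{\mathrm{prin}})$ has no mysterious points. 2. Its upper cluster algebra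 $U_{\mathrm{prin}}=U(\tilde B_{\mathrm{prin}})$ has mysterious points: there is a point of $\mathcal D(\mathcal U_{\mathrm{prin}})$ whose stabilizer in $\operatorname{Aut}(A_{\mathrm{prin}})$ is trivial. 3. For the coefficient-free Markov matrix $B$ (with $n=3$, $m=0$), the cluster algebra $A(B)$ and the upper cluster algebra $U(B)$ both have no mysterious points. -/

import Mathlib

namespace ClusterAlg

/-- The ambient field `ℱ = ℂ(x₁, …, xₙ₊ₘ)`; `Sum.inl` indexes the `n` mutable directions and
`Sum.inr` the `m` frozen ones. -/
abbrev RatFun (n m : ℕ) : Type := FractionRing (MvPolynomial (Fin n ⊕ Fin m) ℂ)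

/-- A labelled seed: an extended cluster together with an extended exchange matrix. The theory is
applied to seeds obtained by iterated mutation from the seed formed by the coordinate functions of
`ℱ` and a matrix with skew-symmetric principal part; all of these have an extended cluster that
freely generates `ℱ` and a matrix with skew-symmetric principal part. -/
@[ext]
structure Seed (n m : ℕ) where
  /-- the extended cluster -/
  var : Fin n ⊕ Fin m → RatFun n m
  /-- the extended exchange matrix -/
  mat : Matrix (Fin n ⊕ Fin m) (Fin n) ℤ

/-- Mutation of an extended exchange matrix in the mutable direction `k`. -/
def mutateMatrix {n m : ℕ} (B : Matrix (Fin n ⊕ Fin m) (Fin n) ℤ) (k : Fin n) :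
    Matrix (Fin n ⊕ Fin m) (Fin n) ℤ :=
  fun i j =>
    if i = Sum.inl k ∨ j = k then -B i j
    else B i j + max (B i k) 0 * max (B (Sum.inl k) j) 0
      - max (-B i k) 0 * max (-B (Sum.inl k) j) 0

/-- Seed mutation in the mutable direction `k`. -/
noncomputable def Seed.mutate {n m : ℕ} (t : Seed n m) (k : Fin n) : Seed n m where
  var := Function.update t.var (Sum.inl k)
    ((t.var (Sum.inl k))⁻¹ *
      (∏ i, t.var i ^ (t.mat i k).toNat + ∏ i, t.var i ^ (-t.mat i k).toNat))
  mat := mutateMatrix t.mat k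

/-- The initial seed: the coordinate functions of `ℱ` with the exchange matrix `B`. -/
noncomputable def initialSeed {n m : ℕ} (B : Matrix (Fin n ⊕ Fin m) (Fin n) ℤ) : Seed n m where
  var := fun i => algebraMap (MvPolynomial (Fin n ⊕ Fin m) ℂ) (RatFun n m) (MvPolynomial.X i)
  mat := B

/-- `IsSeed B t`: the seed `t` is obtained from the initial seed by iterated mutations. -/
inductive IsSeed {n m : ℕ} (B : Matrix (Fin n ⊕ Fin m) (Fin n) ℤ) : Seed n m → Prop
  | initial : IsSeed B (initialSeed B)
  | mutate (t : Seed n m) (k : Fin n) : IsSeed B t → IsSeed B (t.mutate k)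

/-- The mutable cluster variables of all seeds. -/
def clusterVariables {n m : ℕ} (B : Matrix (Fin n ⊕ Fin m) (Fin n) ℤ) : Set (RatFun n m) :=
  {z | ∃ t : Seed n m, IsSeed B t ∧ ∃ i : Fin n, z = t.var (Sum.inl i)}

/-- The frozen variables. -/
def frozenVariables {n m : ℕ} (B : Matrix (Fin n ⊕ Fin m) (Fin n) ℤ) : Set (RatFun n m) :=
  Set.range fun j : Fin m => (initialSeed B).var (Sum.inr j)

/-- The cluster algebra, with inverted frozen variables: the subalgebra of `ℱ` generated by all
cluster variables, the frozen variables and the inverses of the frozen variables. -/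
noncomputable def clusterAlgebra {n m : ℕ} (B : Matrix (Fin n ⊕ Fin m) (Fin n) ℤ) :
    Subalgebra ℂ (RatFun n m) :=
  Algebra.adjoin ℂ (clusterVariables B ∪ frozenVariables B ∪ {z | z⁻¹ ∈ frozenVariables B})

/-- The ring of Laurent polynomials in the extended cluster of the seed `t`. -/
noncomputable def laurentRing {n m : ℕ} (t : Seed n m) : Subalgebra ℂ (RatFun n m) :=
  Algebra.adjoin ℂ (Set.range t.var ∪ Set.range fun i => (t.var i)⁻¹)

/-- The upper cluster algebra: the elements of `ℱ` that are Laurent polynomials in the extended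
cluster of every seed. -/
noncomputable def upperClusterAlgebra {n m : ℕ} (B : Matrix (Fin n ⊕ Fin m) (Fin n) ℤ) :
    Subalgebra ℂ (RatFun n m) :=
  ⨅ (t : Seed n m) (_ : IsSeed B t), laurentRing t

/-- The group of cluster automorphisms: the `ℂ`-algebra automorphisms of the cluster algebra that
rescale each cluster variable and each frozen variable. -/
def clusterAut {n m : ℕ} (B : Matrix (Fin n ⊕ Fin m) (Fin n) ℤ) :
    Subgroup (clusterAlgebra B ≃ₐ[ℂ] clusterAlgebra B) where
  carrier := {φ | ∀ z : clusterAlgebra B,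
    (z : RatFun n m) ∈ clusterVariables B ∪ frozenVariables B →
      ∃ ζ : ℂ, ζ ≠ 0 ∧ φ z = ζ • z}
  one_mem' := fun z _ => ⟨1, one_ne_zero, by simp⟩
  mul_mem' := by
    intro φ ψ hφ hψ z hz
    obtain ⟨a, ha, hφz⟩ := hφ z hz
    obtain ⟨b, hb, hψz⟩ := hψ z hz
    exact ⟨b * a, mul_ne_zero hb ha, by
      rw [AlgEquiv.mul_apply, hψz, map_smul, hφz, smul_smul]⟩
  inv_mem' := by
    intro φ hφ z hz
    obtain ⟨a, ha, hφz⟩ := hφ z hz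
    refine ⟨a⁻¹, inv_ne_zero ha, ?_⟩
    apply φ.injective
    rw [map_smul, hφz, smul_smul, inv_mul_cancel₀ ha, one_smul]
    exact φ.apply_symm_apply z

/-! ### Cluster automorphisms act on the upper cluster algebra -/

theorem IsSeed.var_inr {n m : ℕ} {B : Matrix (Fin n ⊕ Fin m) (Fin n) ℤ} {t : Seed n m}
    (h : IsSeed B t) (j : Fin m) : t.var (Sum.inr j) = (initialSeed B).var (Sum.inr j) := by
  induction h with
  | initial => rfl
  | mutate t k _ ih => simpa [Seed.mutate] using ih

theorem IsSeed.var_mem {n m : ℕ} {B : Matrix (Fin n ⊕ Fin m) (Fin n) ℤ} {t : Seed n m}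
    (h : IsSeed B t) (i : Fin n ⊕ Fin m) :
    t.var i ∈ clusterVariables B ∪ frozenVariables B := by
  rcases i with i | j
  · exact Or.inl ⟨t, h, i, rfl⟩
  · exact Or.inr ⟨j, (h.var_inr j).symm⟩

theorem IsSeed.var_mem_clusterAlgebra {n m : ℕ} {B : Matrix (Fin n ⊕ Fin m) (Fin n) ℤ}
    {t : Seed n m} (h : IsSeed B t) (i : Fin n ⊕ Fin m) : t.var i ∈ clusterAlgebra B :=
  Algebra.subset_adjoin (Or.inl (h.var_mem i))

theorem algebraMap_mem_clusterAlgebra {n m : ℕ} (B : Matrix (Fin n ⊕ Fin m) (Fin n) ℤ)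
    (p : MvPolynomial (Fin n ⊕ Fin m) ℂ) :
    algebraMap (MvPolynomial (Fin n ⊕ Fin m) ℂ) (RatFun n m) p ∈ clusterAlgebra B := by
  induction p using MvPolynomial.induction_on with
  | C a =>
    have h : algebraMap (MvPolynomial (Fin n ⊕ Fin m) ℂ) (RatFun n m) (MvPolynomial.C a)
        = algebraMap ℂ (RatFun n m) a := by
      rw [IsScalarTower.algebraMap_apply ℂ (MvPolynomial (Fin n ⊕ Fin m) ℂ) (RatFun n m)]
      rfl
    rw [h]
    exact Subalgebra.algebraMap_mem _ a
  | add p q hp hq => rw [map_add]; exact add_mem hp hq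
  | mul_X p i hp =>
    rw [map_mul]
    exact mul_mem hp (IsSeed.initial.var_mem_clusterAlgebra i)

/-- `ℱ` is the fraction field of the cluster algebra. -/
instance isFractionRing_clusterAlgebra {n m : ℕ} (B : Matrix (Fin n ⊕ Fin m) (Fin n) ℤ) :
    IsFractionRing (clusterAlgebra B) (RatFun n m) :=
  IsFractionRing.of_field (clusterAlgebra B) (RatFun n m) (fun z => by
    obtain ⟨p, q, -, rfl⟩ := IsFractionRing.div_surjective (MvPolynomial (Fin n ⊕ Fin m) ℂ) z
    exact ⟨⟨_, algebraMap_mem_clusterAlgebra B p⟩, ⟨_, algebraMap_mem_clusterAlgebra B q⟩, rfl⟩)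

/-- The extension of a cluster automorphism to the field `ℱ`. -/
noncomputable def fieldAut {n m : ℕ} (B : Matrix (Fin n ⊕ Fin m) (Fin n) ℤ) :
    clusterAut B →* (RatFun n m ≃ₐ[ℂ] RatFun n m) :=
  (IsFractionRing.fieldEquivOfAlgEquivHom ℂ (RatFun n m)).comp (clusterAut B).subtype

theorem fieldAut_coe {n m : ℕ} {B : Matrix (Fin n ⊕ Fin m) (Fin n) ℤ} (φ : clusterAut B)
    (a : clusterAlgebra B) :
    fieldAut B φ (a : RatFun n m) = ((φ : clusterAlgebra B ≃ₐ[ℂ] clusterAlgebra B) a) :=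
  IsFractionRing.fieldEquivOfAlgEquiv_algebraMap ℂ (RatFun n m) (RatFun n m)
    (φ : clusterAlgebra B ≃ₐ[ℂ] clusterAlgebra B) a

theorem fieldAut_mem_laurentRing {n m : ℕ} {B : Matrix (Fin n ⊕ Fin m) (Fin n) ℤ}
    (φ : clusterAut B) {t : Seed n m} (ht : IsSeed B t) {u : RatFun n m}
    (hu : u ∈ laurentRing t) : fieldAut B φ u ∈ laurentRing t := by
  have hvar : ∀ i, ∃ ζ : ℂ, fieldAut B φ (t.var i) = ζ • t.var i := fun i => by
    obtain ⟨ζ, -, h⟩ := φ.2 ⟨t.var i, ht.var_mem_clusterAlgebra i⟩ (ht.var_mem i)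
    exact ⟨ζ, by rw [fieldAut_coe φ ⟨t.var i, ht.var_mem_clusterAlgebra i⟩, h]; rfl⟩
  suffices h : laurentRing t ≤
      (laurentRing t).comap (AlgEquiv.toAlgHom (fieldAut B φ)) from h hu
  refine Algebra.adjoin_le ?_
  rintro _ (⟨i, rfl⟩ | ⟨i, rfl⟩)
  · obtain ⟨ζ, h⟩ := hvar i
    change fieldAut B φ (t.var i) ∈ laurentRing t
    rw [h, Algebra.smul_def]
    exact mul_mem (Subalgebra.algebraMap_mem _ ζ) (Algebra.subset_adjoin (Or.inl ⟨i, rfl⟩))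
  · obtain ⟨ζ, h⟩ := hvar i
    change fieldAut B φ (t.var i)⁻¹ ∈ laurentRing t
    rw [map_inv₀, h, Algebra.smul_def, mul_inv, ← map_inv₀]
    exact mul_mem (Subalgebra.algebraMap_mem _ ζ⁻¹) (Algebra.subset_adjoin (Or.inr ⟨i, rfl⟩))

theorem fieldAut_mem_upper {n m : ℕ} {B : Matrix (Fin n ⊕ Fin m) (Fin n) ℤ}
    (φ : clusterAut B) {u : RatFun n m} (hu : u ∈ upperClusterAlgebra B) :
    fieldAut B φ u ∈ upperClusterAlgebra B := by
  simp only [upperClusterAlgebra, Algebra.mem_iInf] at hu ⊢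
  exact fun t ht => fieldAut_mem_laurentRing φ ht (hu t ht)

/-- The action of the cluster automorphisms on the upper cluster algebra, by extending a cluster
automorphism to `ℱ` and restricting the extension. -/
noncomputable def upperAction {n m : ℕ} (B : Matrix (Fin n ⊕ Fin m) (Fin n) ℤ) :
    clusterAut B →* (upperClusterAlgebra B ≃ₐ[ℂ] upperClusterAlgebra B) where
  toFun φ := AlgEquiv.ofAlgHom
    (((fieldAut B φ : RatFun n m →ₐ[ℂ] RatFun n m).comp (upperClusterAlgebra B).val).codRestrict
      (upperClusterAlgebra B) fun u => fieldAut_mem_upper φ u.2)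
    (((fieldAut B φ⁻¹ : RatFun n m →ₐ[ℂ] RatFun n m).comp (upperClusterAlgebra B).val).codRestrict
      (upperClusterAlgebra B) fun u => fieldAut_mem_upper φ⁻¹ u.2)
    (by
      ext u
      change fieldAut B φ (fieldAut B φ⁻¹ (u : RatFun n m)) = u
      rw [← AlgEquiv.mul_apply, ← map_mul, mul_inv_cancel, map_one, AlgEquiv.one_apply])
    (by
      ext u
      change fieldAut B φ⁻¹ (fieldAut B φ (u : RatFun n m)) = u
      rw [← AlgEquiv.mul_apply, ← map_mul, inv_mul_cancel, map_one, AlgEquiv.one_apply])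
  map_one' := by
    ext u
    change fieldAut B 1 (u : RatFun n m) = u
    rw [map_one, AlgEquiv.one_apply]
  map_mul' φ ψ := by
    ext u
    change fieldAut B (φ * ψ) (u : RatFun n m) = fieldAut B φ (fieldAut B ψ (u : RatFun n m))
    rw [map_mul, AlgEquiv.mul_apply]

/-! ### Points, cluster tori, deep locus and stabilizer locus -/

/-- The `ℂ`-points of `Spec R`. -/
abbrev Points {n m : ℕ} (R : Subalgebra ℂ (RatFun n m)) : Type := R →ₐ[ℂ] ℂ

/-- The cluster torus of the seed `t` in `Spec R`, for `R` the cluster algebra or the upper cluster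
algebra: the image of the torus `Spec` of the Laurent ring of `t` under restriction along
`R ⊆ laurentRing t`. -/
def clusterTorus {n m : ℕ} (R : Subalgebra ℂ (RatFun n m)) (t : Seed n m) : Set (Points R) :=
  {p | ∃ q : Points (laurentRing t), ∀ (f : RatFun n m) (hR : f ∈ R) (hL : f ∈ laurentRing t),
    p ⟨f, hR⟩ = q ⟨f, hL⟩}

/-- The deep locus of `Spec R`: the complement of the union of all cluster tori. -/
def deepLocus {n m : ℕ} (B : Matrix (Fin n ⊕ Fin m) (Fin n) ℤ) (R : Subalgebra ℂ (RatFun n m)) :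
    Set (Points R) :=
  {p | ∀ t : Seed n m, IsSeed B t → p ∉ clusterTorus R t}

/-- The stabilizer of a point of `Spec R` under a group acting on `R` by algebra automorphisms. -/
def pointStabilizer {G : Type*} [Group G] {n m : ℕ} {R : Subalgebra ℂ (RatFun n m)}
    (ρ : G →* (R ≃ₐ[ℂ] R)) (p : Points R) : Subgroup G where
  carrier := {g | ∀ r : R, p (ρ g r) = p r}
  one_mem' := fun r => by simp
  mul_mem' := by
    intro g h hg hh r
    rw [map_mul, AlgEquiv.mul_apply, hg, hh]
  inv_mem' := by
    intro g hg r
    rw [← hg, ← AlgEquiv.mul_apply, ← map_mul, mul_inv_cancel, map_one, AlgEquiv.one_apply]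

/-- The stabilizer locus: the points with nontrivial stabilizer. -/
def stabilizerLocus {G : Type*} [Group G] {n m : ℕ} {R : Subalgebra ℂ (RatFun n m)}
    (ρ : G →* (R ≃ₐ[ℂ] R)) : Set (Points R) :=
  {p | pointStabilizer ρ p ≠ ⊥}

/-- The action of the cluster automorphisms on the cluster algebra. -/
noncomputable def clusterAction {n m : ℕ} (B : Matrix (Fin n ⊕ Fin m) (Fin n) ℤ) :
    clusterAut B →* (clusterAlgebra B ≃ₐ[ℂ] clusterAlgebra B) :=
  (clusterAut B).subtype

/-- The cluster algebra has no mysterious points. -/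
def ClusterHasNoMysteriousPoints {n m : ℕ} (B : Matrix (Fin n ⊕ Fin m) (Fin n) ℤ) : Prop :=
  stabilizerLocus (clusterAction B) = deepLocus B (clusterAlgebra B)

/-- The upper cluster algebra has no mysterious points. -/
def UpperHasNoMysteriousPoints {n m : ℕ} (B : Matrix (Fin n ⊕ Fin m) (Fin n) ℤ) : Prop :=
  stabilizerLocus (upperAction B) = deepLocus B (upperClusterAlgebra B)

/-- The mysterious points of the upper cluster algebra. -/
def upperMysteriousPoints {n m : ℕ} (B : Matrix (Fin n ⊕ Fin m) (Fin n) ℤ) :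
    Set (Points (upperClusterAlgebra B)) :=
  deepLocus B (upperClusterAlgebra B) \ stabilizerLocus (upperAction B)

/-! ### The Markov exchange matrices -/

/-- The principal part: the exchange matrix of the Markov quiver. -/
def markovPrincipal : Matrix (Fin 3) (Fin 3) ℤ :=
  !![0, -2, 2; 2, 0, -2; -2, 2, 0]

/-- The Markov exchange matrix without frozen rows. -/
def markovMatrix : Matrix (Fin 3 ⊕ Fin 0) (Fin 3) ℤ :=
  Matrix.fromRows markovPrincipal 0

/-- The Markov extended exchange matrix with principal coefficients. -/
def markovPrinMatrix : Matrix (Fin 3 ⊕ Fin 3) (Fin 3) ℤ :=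
  Matrix.fromRows markovPrincipal 1

end ClusterAlg

/-! Mutation of the Markov matrix only reverses its orientation, so in every seed the exchange
relation is `z_k z_k' = a z_{k+s}² + b z_{k-s}²` with frozen monomials `a`, `b`. Since only squares
occur on the right, a sign vector on the three mutable directions acts on all clusters
simultaneously (`IsSeed.fieldSign_var`). For the same reason, at a deep point either all cluster
variables vanish, or exactly those of one mutable direction do (`deepLocus_dichotomy`). In both
cases the sign change in a vanishing direction fixes the values of all generators of `A`, whatever
the frozen rows. Conversely, on a cluster torus all weights of a stabilizing automorphism are `1`,
so stabilizers there are trivial (`stabilizerLocus_subset_deepLocus`).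

The upper cluster algebra has more functions. Over the once-punctured torus it contains closed loops
`ℓ_k` and notched arcs `(u_k ℓ_k² + (1 - u₁u₂u₃)²) / x_k`. The algebra generated by arcs, loops,
notched arcs and invertible coefficients is mutation invariant; this also yields the Laurent
phenomenon. With principal coefficients a notched arc has the weight inverse to that of its arc.
Hence a point of `Spec U` at which all arcs vanish and all notched arcs equal `1` is deep with
trivial stabilizer. Such a point comes from a Hartogs argument: on a plane with coordinates `s`, `t`
where the notched arcs are constantly `1`, the arcs are polynomials that vanish at `(-1/2, -2)`, and
every prime curve through this point meets the torus of the initial seed or of one of its three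
mutations (`exists_not_dvd_slice`). So every element of `U` is regular at the point and can be
evaluated there.

Without coefficients, `U` is generated by `x₀, x₁, x₂` and the mutation invariant Markov element `M
= (x₀² + x₁² + x₂²) / (x₀x₁x₂)` (`upperClusterAlgebra_le_markovAlgebra`). Signs multiply `M` by
their product. If all cluster variables vanish, two simultaneous signs fix the point; if only those
of direction `i` vanish, then `x_{i+1} x_{i-1} M = x_i + x_i'` forces `M = 0`, and one sign
suffices. -/

namespace ClusterAlg

open MvPolynomial

/-! ### Generators and transcendence degree of the ambient field. -/

section FieldGenerators

variable {n m : ℕ}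

theorem adjoin_initialSeed_eq_top (B : Matrix (Fin n ⊕ Fin m) (Fin n) ℤ) :
    IntermediateField.adjoin ℂ (Set.range (initialSeed B).var) = ⊤ := by
  rw [eq_top_iff]
  intro z _
  have hp : ∀ p : MvPolynomial (Fin n ⊕ Fin m) ℂ,
      algebraMap (MvPolynomial (Fin n ⊕ Fin m) ℂ) (RatFun n m) p ∈
        IntermediateField.adjoin ℂ (Set.range (initialSeed B).var) := by
    intro p
    induction p using MvPolynomial.induction_on with
    | C a =>
      have h : algebraMap (MvPolynomial (Fin n ⊕ Fin m) ℂ) (RatFun n m) (MvPolynomial.C a)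
          = algebraMap ℂ (RatFun n m) a := by
        rw [IsScalarTower.algebraMap_apply ℂ (MvPolynomial (Fin n ⊕ Fin m) ℂ) (RatFun n m)]
        rfl
      rw [h]
      exact IntermediateField.algebraMap_mem _ a
    | add p q hp hq => rw [map_add]; exact add_mem hp hq
    | mul_X p i hp =>
      rw [map_mul]
      exact mul_mem hp (IntermediateField.subset_adjoin _ _ ⟨i, rfl⟩)
  obtain ⟨p, q, -, rfl⟩ := IsFractionRing.div_surjective (MvPolynomial (Fin n ⊕ Fin m) ℂ) z
  exact div_mem (hp p) (hp q)

theorem trdeg_ratFun : Algebra.trdeg ℂ (RatFun n m) = ((n + m : ℕ) : Cardinal) := by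
  have : Algebra.IsAlgebraic (MvPolynomial (Fin n ⊕ Fin m) ℂ) (RatFun n m) :=
    IsLocalization.isAlgebraic _ (nonZeroDivisors (MvPolynomial (Fin n ⊕ Fin m) ℂ))
  have h := (IsTranscendenceBasis.mvPolynomial (Fin n ⊕ Fin m) ℂ).algebraMap_comp (A := RatFun n m)
  rw [← h.cardinalMk_eq_trdeg]
  simp

/-- A family of `n + m` elements over which all of `ℱ` is algebraic is algebraically
independent. -/
theorem algebraicIndependent_of_isAlgebraic {ι : Type} [Finite ι] (v : ι → RatFun n m)
    (hcard : Nat.card ι = n + m)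
    (h : ∀ z : RatFun n m, IsAlgebraic (Algebra.adjoin ℂ (Set.range v)) z) :
    AlgebraicIndependent ℂ v := by
  have : Algebra.IsAlgebraic (Algebra.adjoin ℂ (Set.range v)) (RatFun n m) := ⟨h⟩
  refine (Algebra.IsAlgebraic.isTranscendenceBasis_of_le_trdeg_of_finite ℂ v ?_).1
  rw [trdeg_ratFun, ← hcard, Nat.cast_card]

open scoped IntermediateField.algebraAdjoinAdjoin in
theorem isAlgebraic_of_mem_adjoin {S : Set (RatFun n m)} {z : RatFun n m}
    (hz : z ∈ IntermediateField.adjoin ℂ S) : IsAlgebraic (Algebra.adjoin ℂ S) z := by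
  obtain ⟨a, b, hb, h⟩ :=
    IsFractionRing.div_surjective (A := Algebra.adjoin ℂ S)
      (⟨z, hz⟩ : IntermediateField.adjoin ℂ S)
  have : z = algebraMap (Algebra.adjoin ℂ S) (RatFun n m) a /
      algebraMap (Algebra.adjoin ℂ S) (RatFun n m) b := by
    have h' := congrArg (algebraMap (IntermediateField.adjoin ℂ S) (RatFun n m)) h
    rw [map_div₀, ← IsScalarTower.algebraMap_apply, ← IsScalarTower.algebraMap_apply] at h'
    exact h'.symm
  rw [this, div_eq_mul_inv]
  exact (isAlgebraic_algebraMap a).mul (isAlgebraic_algebraMap b).inv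

/-- The number of generators equals the transcendence degree, so there is no room for a relation. -/
theorem algebraicIndependent_of_adjoin_eq_top {v : Fin n ⊕ Fin m → RatFun n m}
    (h : IntermediateField.adjoin ℂ (Set.range v) = ⊤) : AlgebraicIndependent ℂ v :=
  algebraicIndependent_of_isAlgebraic v (by simp)
    fun _ => isAlgebraic_of_mem_adjoin (h ▸ IntermediateField.mem_top)

end FieldGenerators

/-! ### Seeds of Markov type: orientation, exchange relations, independence of clusters. -/

section Orientation

variable {m : ℕ}

/-- `Oriented M s`: the principal part of `M` is the exchange matrix of the Markov quiver
(`s = 1`) or its negative (`s = 2`). -/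
def Oriented (M : Matrix (Fin 3 ⊕ Fin m) (Fin 3) ℤ) (s : Fin 3) : Prop :=
  s ≠ 0 ∧ ∀ k, M (Sum.inl k) k = 0 ∧ M (Sum.inl (k + s)) k = 2 ∧ M (Sum.inl (k - s)) k = -2

theorem fin_three_add_add (k s : Fin 3) : k + s + s = k - s := by
  revert k s; decide

theorem fin_three_sub_sub (k s : Fin 3) : k - s - s = k + s := by
  revert k s; decide

theorem fin_three_add_ne {s : Fin 3} (hs : s ≠ 0) (k : Fin 3) : k + s ≠ k := by
  simpa using hs

theorem fin_three_sub_ne {s : Fin 3} (hs : s ≠ 0) (k : Fin 3) : k - s ≠ k := by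
  simpa [sub_eq_add_neg] using hs

theorem fin_three_sub_ne_add {s : Fin 3} (hs : s ≠ 0) (k : Fin 3) : k - s ≠ k + s := by
  revert hs; revert s k; decide

theorem eq_or_cyclic (i k : Fin 3) {s : Fin 3} (hs : s ≠ 0) :
    i = k ∨ i = k + s ∨ i = k - s := by
  revert hs; revert s i k; decide

/-- Entries in row or column `k` change sign by definition; the remaining entries `±2` are corrected
by `∓4`, which again reverses their sign. -/
theorem Oriented.mutate {M : Matrix (Fin 3 ⊕ Fin m) (Fin 3) ℤ} {s : Fin 3} (h : Oriented M s)
    (k : Fin 3) : Oriented (mutateMatrix M k) (-s) := by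
  obtain ⟨hs, h⟩ := h
  have n1 := fin_three_add_ne hs k
  have n2 := fin_three_sub_ne hs k
  have n3 := fin_three_sub_ne_add hs k
  obtain ⟨a0, b0, c0⟩ := h k
  obtain ⟨a1, b1, c1⟩ := h (k + s)
  obtain ⟨a2, b2, c2⟩ := h (k - s)
  rw [fin_three_add_add] at b1
  rw [add_sub_cancel_right] at c1
  rw [sub_add_cancel] at b2
  rw [fin_three_sub_sub] at c2
  refine ⟨by simpa using hs, fun j => ?_⟩
  rw [sub_neg_eq_add, ← sub_eq_add_neg]
  rcases eq_or_cyclic j k hs with rfl | rfl | rfl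
  · simp [mutateMatrix, a0, b0, c0]
  · rw [fin_three_add_add, add_sub_cancel_right]
    simp [mutateMatrix, b0, c0, a1, b1, c1, n1, n2]
  · rw [fin_three_sub_sub, sub_add_cancel]
    simp [mutateMatrix, b0, c0, a2, b2, c2, n1, n2]

theorem Oriented.mutate_frozen {M : Matrix (Fin 3 ⊕ Fin m) (Fin 3) ℤ} {s : Fin 3}
    (h : Oriented M s) (k : Fin 3) (a : Fin m) :
    mutateMatrix M k (Sum.inr a) k = - M (Sum.inr a) k ∧
    mutateMatrix M k (Sum.inr a) (k + s) =
      M (Sum.inr a) (k + s) - 2 * max (- M (Sum.inr a) k) 0 ∧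
    mutateMatrix M k (Sum.inr a) (k - s) =
      M (Sum.inr a) (k - s) + 2 * max (M (Sum.inr a) k) 0 := by
  have h1 : M (Sum.inl k) (k + s) = -2 := by simpa using (h.2 (k + s)).2.2
  have h2 : M (Sum.inl k) (k - s) = 2 := by simpa using (h.2 (k - s)).2.1
  refine ⟨by simp [mutateMatrix], ?_, ?_⟩
  · have : k + s ≠ k := by simpa using h.1
    simp [mutateMatrix, this, h1, mul_comm]
  · have : k - s ≠ k := by simpa [sub_eq_add_neg] using h.1
    simp [mutateMatrix, this, h2, mul_comm]

theorem prod_fin_three_cyclic {R : Type*} [CommMonoid R] (f : Fin 3 → R) (k : Fin 3) {s : Fin 3}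
    (hs : s ≠ 0) : ∏ i, f i = f k * f (k + s) * f (k - s) := by
  have h1 : (Finset.univ : Finset (Fin 3)) = {k, k + s, k - s} := by
    revert hs; revert k s; decide
  have n1 := (fin_three_add_ne hs k).symm
  have n2 := (fin_three_sub_ne hs k).symm
  have n3 := (fin_three_sub_ne_add hs k).symm
  rw [h1, Finset.prod_insert (by simp [n1, n2]), Finset.prod_insert (by simpa using n3),
    Finset.prod_singleton, mul_assoc]

/-- The monomial in the frozen variables with the positive entries of the column `k`. -/
noncomputable def Seed.posCoeff (t : Seed 3 m) (k : Fin 3) : RatFun 3 m :=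
  ∏ a, t.var (Sum.inr a) ^ (t.mat (Sum.inr a) k).toNat

/-- The monomial in the frozen variables with the negative entries of the column `k`. -/
noncomputable def Seed.negCoeff (t : Seed 3 m) (k : Fin 3) : RatFun 3 m :=
  ∏ a, t.var (Sum.inr a) ^ (-t.mat (Sum.inr a) k).toNat

/-- The Laurent monomial in the frozen variables given by the column `k`. -/
noncomputable def Seed.coeff (t : Seed 3 m) (k : Fin 3) : RatFun 3 m :=
  ∏ a, t.var (Sum.inr a) ^ (t.mat (Sum.inr a) k)

theorem Seed.exchange_numerator (t : Seed 3 m) {s : Fin 3} (h : Oriented t.mat s) (k : Fin 3) :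
    ∏ i, t.var i ^ (t.mat i k).toNat + ∏ i, t.var i ^ (-t.mat i k).toNat =
      t.posCoeff k * t.var (Sum.inl (k + s)) ^ 2 + t.negCoeff k * t.var (Sum.inl (k - s)) ^ 2 := by
  obtain ⟨h0, h1, h2⟩ := h.2 k
  rw [Fintype.prod_sum_type, Fintype.prod_sum_type, prod_fin_three_cyclic _ k h.1,
    prod_fin_three_cyclic _ k h.1, h0, h1, h2, Seed.posCoeff, Seed.negCoeff]
  simp [mul_comm]

theorem Seed.mutate_var_self (t : Seed 3 m) {s : Fin 3} (h : Oriented t.mat s) (k : Fin 3) :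
    (t.mutate k).var (Sum.inl k) = (t.var (Sum.inl k))⁻¹ *
      (t.posCoeff k * t.var (Sum.inl (k + s)) ^ 2 +
        t.negCoeff k * t.var (Sum.inl (k - s)) ^ 2) := by
  rw [← t.exchange_numerator h k]
  simp [Seed.mutate]

theorem Seed.mutate_var_of_ne {n : ℕ} (t : Seed n m) (k : Fin n) {i : Fin n ⊕ Fin m}
    (hi : i ≠ Sum.inl k) : (t.mutate k).var i = t.var i := by
  simp [Seed.mutate, hi]

/-- By independence it suffices that the polynomial is nonzero, and its value at the all-ones point
is `2`. -/
theorem Seed.exchange_numerator_ne_zero (t : Seed 3 m) (ht : AlgebraicIndependent ℂ t.var)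
    (k : Fin 3) : ∏ i, t.var i ^ (t.mat i k).toNat + ∏ i, t.var i ^ (-t.mat i k).toNat ≠ 0 := by
  intro h
  have h' : aeval t.var (∏ i, X i ^ (t.mat i k).toNat + ∏ i, X i ^ (-t.mat i k).toNat :
      MvPolynomial (Fin 3 ⊕ Fin m) ℂ) = 0 := by
    simpa [map_prod] using h
  have h0 := (map_eq_zero_iff _ ht).1 h'
  have h1 := congrArg (MvPolynomial.eval (fun _ => (1 : ℂ))) h0
  simp [map_prod] at h1

variable {B : Matrix (Fin 3 ⊕ Fin m) (Fin 3) ℤ}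

theorem IsSeed.exists_oriented {s : Fin 3} (hB : Oriented B s) {t : Seed 3 m} (ht : IsSeed B t) :
    ∃ s', Oriented t.mat s' := by
  induction ht with
  | initial => exact ⟨s, hB⟩
  | mutate t k _ ih =>
    obtain ⟨s', h⟩ := ih
    exact ⟨-s', h.mutate k⟩

/-- The exchange relation can be solved for the old variable as well; hence each cluster generates
the whole field. -/
theorem Seed.mem_of_mutate_mem (t : Seed 3 m) {s : Fin 3} (h : Oriented t.mat s)
    (ht : AlgebraicIndependent ℂ t.var) (k : Fin 3)
    (K : IntermediateField ℂ (RatFun 3 m)) (hK : ∀ i, (t.mutate k).var i ∈ K) (i) :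
    t.var i ∈ K := by
  by_cases hi : i = Sum.inl k
  · subst hi
    have hP : t.posCoeff k * t.var (Sum.inl (k + s)) ^ 2 +
        t.negCoeff k * t.var (Sum.inl (k - s)) ^ 2 ∈ K := by
      have h1 : ∀ j, j ≠ Sum.inl k → t.var j ∈ K := fun j hj => by
        simpa [t.mutate_var_of_ne k hj] using hK j
      have h2 : t.var (Sum.inl (k + s)) ∈ K := h1 _ (by simpa using h.1)
      have h3 : t.var (Sum.inl (k - s)) ∈ K :=
        h1 _ (by simpa [sub_eq_add_neg] using h.1)
      refine add_mem (mul_mem (prod_mem fun a _ => pow_mem (h1 _ (by simp)) _) (pow_mem h2 _))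
        (mul_mem (prod_mem fun a _ => pow_mem (h1 _ (by simp)) _) (pow_mem h3 _))
    have hP0 := t.exchange_numerator_ne_zero ht k
    rw [t.exchange_numerator h k] at hP0
    have h4 := t.mutate_var_self h k
    have h5 : t.var (Sum.inl k) = (t.posCoeff k * t.var (Sum.inl (k + s)) ^ 2 +
        t.negCoeff k * t.var (Sum.inl (k - s)) ^ 2) * ((t.mutate k).var (Sum.inl k))⁻¹ := by
      rw [h4, mul_inv, inv_inv]
      field_simp
    rw [h5]
    exact mul_mem hP (inv_mem (hK _))
  · simpa [t.mutate_var_of_ne k hi] using hK i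

theorem IsSeed.adjoin_eq_top {s : Fin 3} (hB : Oriented B s) {t : Seed 3 m} (ht : IsSeed B t) :
    IntermediateField.adjoin ℂ (Set.range t.var) = ⊤ := by
  induction ht with
  | initial => exact adjoin_initialSeed_eq_top B
  | mutate t k ht ih =>
    obtain ⟨s', h⟩ := ht.exists_oriented hB
    rw [eq_top_iff, ← ih, IntermediateField.adjoin_le_iff]
    rintro _ ⟨i, rfl⟩
    exact t.mem_of_mutate_mem h (algebraicIndependent_of_adjoin_eq_top ih) k _
      (fun j => IntermediateField.subset_adjoin ℂ _ (Set.mem_range_self j)) i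

theorem IsSeed.algebraicIndependent {s : Fin 3} (hB : Oriented B s) {t : Seed 3 m}
    (ht : IsSeed B t) : AlgebraicIndependent ℂ t.var :=
  algebraicIndependent_of_adjoin_eq_top (ht.adjoin_eq_top hB)

theorem IsSeed.var_ne_zero {s : Fin 3} (hB : Oriented B s) {t : Seed 3 m}
    (ht : IsSeed B t) (i) : t.var i ≠ 0 :=
  (ht.algebraicIndependent hB).ne_zero i

theorem IsSeed.exchange {s : Fin 3} (hB : Oriented B s) {t : Seed 3 m} (ht : IsSeed B t)
    {s' : Fin 3} (h : Oriented t.mat s') (k : Fin 3) :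
    t.var (Sum.inl k) * (t.mutate k).var (Sum.inl k) =
      t.posCoeff k * t.var (Sum.inl (k + s')) ^ 2 +
        t.negCoeff k * t.var (Sum.inl (k - s')) ^ 2 := by
  rw [t.mutate_var_self h k, mul_inv_cancel_left₀ (ht.var_ne_zero hB _)]

theorem IsSeed.algHom_ext {s : Fin 3} (hB : Oriented B s) {t : Seed 3 m} (ht : IsSeed B t)
    {K : Type*} [Field K] [Algebra ℂ K]
    {σ τ : RatFun 3 m →ₐ[ℂ] K} (h : ∀ i, σ (t.var i) = τ (t.var i)) : σ = τ := by
  refine AlgHom.ext fun z => ?_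
  have hz : z ∈ IntermediateField.adjoin ℂ (Set.range t.var) :=
    ht.adjoin_eq_top hB ▸ IntermediateField.mem_top
  induction hz using IntermediateField.adjoin_induction with
  | mem x hx => obtain ⟨i, rfl⟩ := hx; exact h i
  | algebraMap x => rw [AlgHom.commutes, AlgHom.commutes]
  | add x y _ _ hx hy => rw [map_add, map_add, hx, hy]
  | inv x _ hx => rw [map_inv₀, map_inv₀, hx]
  | mul x y _ _ hx hy => rw [map_mul, map_mul, hx, hy]

end Orientation

end ClusterAlg

namespace ClusterAlg

open MvPolynomial

/-! ### Laurent rings as localizations, and cluster tori as nonvanishing loci. -/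

section LaurentRing

variable {n m : ℕ}

theorem var_mem_laurentRing (t : Seed n m) (i) : t.var i ∈ laurentRing t :=
  Algebra.subset_adjoin (Or.inl ⟨i, rfl⟩)

theorem var_inv_mem_laurentRing (t : Seed n m) (i) : (t.var i)⁻¹ ∈ laurentRing t :=
  Algebra.subset_adjoin (Or.inr ⟨i, rfl⟩)

theorem exists_mul_prod_pow_eq_aeval {t : Seed n m} (h0 : ∀ i, t.var i ≠ 0) {f : RatFun n m}
    (hf : f ∈ laurentRing t) :
    ∃ (N : ℕ) (g : MvPolynomial (Fin n ⊕ Fin m) ℂ),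
      f * (∏ i, t.var i) ^ N = aeval t.var g := by
  classical
  have hX : aeval t.var (∏ i, X i : MvPolynomial (Fin n ⊕ Fin m) ℂ) = ∏ i, t.var i := by
    simp [map_prod]
  induction hf using Algebra.adjoin_induction with
  | mem x hx =>
    rcases hx with ⟨i, rfl⟩ | ⟨i, rfl⟩
    · exact ⟨0, X i, by simp⟩
    · refine ⟨1, ∏ j ∈ Finset.univ.erase i, X j, ?_⟩
      rw [pow_one, ← Finset.mul_prod_erase Finset.univ t.var (Finset.mem_univ i),
        inv_mul_cancel_left₀ (h0 i), map_prod]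
      simp
  | algebraMap a => exact ⟨0, C a, by simp⟩
  | add x y _ _ hx hy =>
    obtain ⟨N, g, hg⟩ := hx
    obtain ⟨N', g', hg'⟩ := hy
    refine ⟨N + N', g * (∏ i, X i) ^ N' + g' * (∏ i, X i) ^ N, ?_⟩
    rw [map_add, map_mul, map_mul, map_pow, map_pow, hX, ← hg, ← hg']
    ring
  | mul x y _ _ hx hy =>
    obtain ⟨N, g, hg⟩ := hx
    obtain ⟨N', g', hg'⟩ := hy
    refine ⟨N + N', g * g', ?_⟩
    rw [map_mul, ← hg, ← hg']
    ring

theorem coe_aeval_subtype {t : Seed n m} {R : Subalgebra ℂ (RatFun n m)}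
    (hR : ∀ i, t.var i ∈ R) (g : MvPolynomial (Fin n ⊕ Fin m) ℂ) :
    ((aeval (fun i => (⟨t.var i, hR i⟩ : R)) g : R) : RatFun n m) = aeval t.var g := by
  have : R.val.comp (aeval (fun i => (⟨t.var i, hR i⟩ : R))) = aeval t.var := by
    ext i
    simp
  exact DFunLike.congr_fun this g

/-- A point of a torus: prescribing nonzero values of the variables of an algebraically independent
extended cluster determines a homomorphism on its Laurent ring. -/
theorem exists_laurentRing_algHom {t : Seed n m} (ht : AlgebraicIndependent ℂ t.var)
    {K : Type*} [Field K] [Algebra ℂ K] (c : Fin n ⊕ Fin m → K) (hc : ∀ i, c i ≠ 0) :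
    ∃ q : laurentRing t →ₐ[ℂ] K, ∀ i, q ⟨t.var i, var_mem_laurentRing t i⟩ = c i := by
  let A := MvPolynomial (Fin n ⊕ Fin m) ℂ
  let ι : A →ₐ[ℂ] laurentRing t := aeval fun i => ⟨t.var i, var_mem_laurentRing t i⟩
  have hι : ∀ g, ((ι g : laurentRing t) : RatFun n m) = aeval t.var g :=
    coe_aeval_subtype (var_mem_laurentRing t)
  have h0 : ∀ i, t.var i ≠ 0 := fun i => ht.ne_zero i
  have hP : aeval t.var (∏ i, X i : A) = ∏ i, t.var i := by simp [map_prod]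
  let : Algebra A (laurentRing t) := ι.toRingHom.toAlgebra
  have hmap : ∀ g : A, algebraMap A (laurentRing t) g = ι g := fun _ => rfl
  have hprod : ∏ i, t.var i ≠ 0 := Finset.prod_ne_zero_iff.2 fun i _ => h0 i
  -- By independence, the Laurent ring is the polynomial ring with the product of all variables
  -- inverted, so homomorphisms out of it are choices of nonzero values.
  have loc : IsLocalization.Away (∏ i, X i : A) (laurentRing t) := by
    refine IsLocalization.Away.mk (R := A) (S := laurentRing t) (∏ i, X i : A) ?_ ?_ ?_
    · rw [hmap, isUnit_iff_exists_inv]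
      refine ⟨∏ i, ⟨(t.var i)⁻¹, var_inv_mem_laurentRing t i⟩, Subtype.ext ?_⟩
      simp only [MulMemClass.coe_mul, hι, hP, SubmonoidClass.coe_finsetProd, OneMemClass.coe_one]
      rw [Finset.prod_inv_distrib, mul_inv_cancel₀ hprod]
    · rintro ⟨f, hf⟩
      obtain ⟨N, g, hg⟩ := exists_mul_prod_pow_eq_aeval h0 hf
      refine ⟨N, g, Subtype.ext ?_⟩
      rw [hmap, hmap]
      simp only [MulMemClass.coe_mul, SubmonoidClass.coe_pow, hι, hP, hg]
    · intro a b hab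
      refine ⟨0, ?_⟩
      rw [hmap, hmap] at hab
      have := congrArg Subtype.val hab
      rw [hι, hι] at this
      rw [ht this]
  have hcP : IsUnit ((aeval c : A →ₐ[ℂ] K).toRingHom (∏ i, X i : A)) := by
    refine IsUnit.mk0 _ ?_
    simpa [map_prod, Finset.prod_ne_zero_iff] using hc
  let q := IsLocalization.Away.lift (S := laurentRing t) (∏ i, X i : A) hcP
  have hq : ∀ g : A, q (ι g) = aeval c g :=
    fun g => IsLocalization.Away.lift_eq (S := laurentRing t) (∏ i, X i : A) hcP g
  refine ⟨{ q with commutes' := fun a => ?_ }, fun i => ?_⟩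
  · have := hq (C a)
    rw [← algebraMap_eq, AlgHom.commutes, AlgHom.commutes] at this
    exact this
  · have := hq (X i)
    rw [show ι (X i) = ⟨t.var i, var_mem_laurentRing t i⟩ from aeval_X _ _, aeval_X] at this
    exact this

/-- `N` and `g` are chosen before `R`, so that one identity can be evaluated both in `R` and in the
Laurent ring. -/
theorem exists_mul_prod_pow_eq_aeval_subtype {t : Seed n m} (h0 : ∀ i, t.var i ≠ 0)
    {f : RatFun n m} (hL : f ∈ laurentRing t) :
    ∃ (N : ℕ) (g : MvPolynomial (Fin n ⊕ Fin m) ℂ), ∀ (R : Subalgebra ℂ (RatFun n m))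
      (hR : ∀ i, t.var i ∈ R) (hf : f ∈ R),
      (⟨f, hf⟩ : R) * (∏ i, ⟨t.var i, hR i⟩) ^ N = aeval (fun i => ⟨t.var i, hR i⟩) g := by
  obtain ⟨N, g, hg⟩ := exists_mul_prod_pow_eq_aeval h0 hL
  refine ⟨N, g, fun R hR hf => Subtype.ext ?_⟩
  rw [coe_aeval_subtype hR, ← hg]
  simp

/-- The value of a homomorphism at an element of the Laurent ring of `t` is determined by its
values at the extended cluster. -/
theorem map_mul_prod_pow_eq {t : Seed n m} (h0 : ∀ i, t.var i ≠ 0)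
    {f : RatFun n m} (hL : f ∈ laurentRing t) :
    ∃ (N : ℕ) (g : MvPolynomial (Fin n ⊕ Fin m) ℂ), ∀ (R : Subalgebra ℂ (RatFun n m))
      (hR : ∀ i, t.var i ∈ R) (hf : f ∈ R) (K : Type) [Field K] [Algebra ℂ K] (p : R →ₐ[ℂ] K),
      p ⟨f, hf⟩ * (∏ i, p ⟨t.var i, hR i⟩) ^ N = aeval (fun i => p ⟨t.var i, hR i⟩) g := by
  obtain ⟨N, g, hg⟩ := exists_mul_prod_pow_eq_aeval_subtype h0 hL
  refine ⟨N, g, fun R hR hf K _ _ p => ?_⟩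
  have h := congrArg p (hg R hR hf)
  rw [map_mul, map_pow, map_prod, comp_aeval_apply] at h
  exact h

theorem mem_clusterTorus_iff {t : Seed n m} (ht : AlgebraicIndependent ℂ t.var)
    {R : Subalgebra ℂ (RatFun n m)} (hR : ∀ i, t.var i ∈ R) (p : Points R) :
    p ∈ clusterTorus R t ↔ ∀ i, p ⟨t.var i, hR i⟩ ≠ 0 := by
  have h0 : ∀ i, t.var i ≠ 0 := fun i => ht.ne_zero i
  constructor
  · rintro ⟨q, hq⟩ i hi
    rw [hq _ _ (var_mem_laurentRing t i)] at hi
    have h1 : q ⟨t.var i, var_mem_laurentRing t i⟩ *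
        q ⟨(t.var i)⁻¹, var_inv_mem_laurentRing t i⟩ = 1 := by
      rw [← map_mul, ← map_one q]
      congr 1
      exact Subtype.ext (mul_inv_cancel₀ (h0 i))
    rw [hi, zero_mul] at h1
    exact zero_ne_one h1
  · intro hp
    obtain ⟨q, hq⟩ := exists_laurentRing_algHom ht (fun i => p ⟨t.var i, hR i⟩) hp
    refine ⟨q, fun f hf hL => ?_⟩
    obtain ⟨N, g, hg⟩ := map_mul_prod_pow_eq h0 hL
    have h1 := hg R hR hf ℂ p
    have h2 := hg (laurentRing t) (var_mem_laurentRing t) hL ℂ q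
    simp only [hq] at h2
    exact mul_right_cancel₀ (pow_ne_zero N (Finset.prod_ne_zero_iff.2 fun i _ => hp i))
      (h1.trans h2.symm)

end LaurentRing

end ClusterAlg

namespace ClusterAlg

open MvPolynomial

variable {m : ℕ} {B : Matrix (Fin 3 ⊕ Fin m) (Fin 3) ℤ}

/-! ### Stabilizers are trivial on cluster tori. -/

section StabilizerSubsetDeep

theorem exists_fieldAut_smul (φ : clusterAut B) {z : RatFun 3 m}
    (hz : z ∈ clusterVariables B ∪ frozenVariables B) :
    ∃ ζ : ℂ, ζ ≠ 0 ∧ fieldAut B φ z = ζ • z := by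
  have hA : z ∈ clusterAlgebra B := Algebra.subset_adjoin (Or.inl hz)
  obtain ⟨ζ, h0, h⟩ := φ.2 ⟨z, hA⟩ hz
  exact ⟨ζ, h0, by rw [fieldAut_coe φ ⟨z, hA⟩, h]; rfl⟩

theorem eq_one_of_fieldAut_fixes {s : Fin 3} (hB : Oriented B s) {t : Seed 3 m}
    (ht : IsSeed B t) {φ : clusterAut B} (h : ∀ i, fieldAut B φ (t.var i) = t.var i) :
    φ = 1 := by
  have h1 : AlgHomClass.toAlgHom (fieldAut B φ) = AlgHom.id ℂ (RatFun 3 m) :=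
    ht.algHom_ext hB h
  apply Subtype.ext
  refine AlgEquiv.ext fun a => Subtype.ext ?_
  rw [← fieldAut_coe φ a]
  exact DFunLike.congr_fun h1 _

/-- An action of the cluster automorphisms on a subalgebra of `ℱ` is the restriction of the action
on `ℱ`. -/
def IsRestrictedAction {R : Subalgebra ℂ (RatFun 3 m)} (ρ : clusterAut B →* (R ≃ₐ[ℂ] R)) : Prop :=
  ∀ φ (r : R), ((ρ φ r : R) : RatFun 3 m) = fieldAut B φ r

theorem isRestrictedAction_clusterAction : IsRestrictedAction (clusterAction B) :=
  fun φ r => (fieldAut_coe φ r).symm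

theorem isRestrictedAction_upperAction : IsRestrictedAction (upperAction B) :=
  fun _ _ => rfl

/-- At a torus point no variable of the cluster vanishes, so invariance of its value forces weight
`1`; an automorphism fixing a cluster is the identity, because the cluster generates the field. -/
theorem stabilizerLocus_subset_deepLocus {s : Fin 3} (hB : Oriented B s)
    {R : Subalgebra ℂ (RatFun 3 m)} (hR : ∀ t : Seed 3 m, IsSeed B t → ∀ i, t.var i ∈ R)
    {ρ : clusterAut B →* (R ≃ₐ[ℂ] R)} (hρ : IsRestrictedAction ρ) :
    stabilizerLocus ρ ⊆ deepLocus B R := by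
  intro p hp t ht hmem
  rw [mem_clusterTorus_iff (ht.algebraicIndependent hB) (hR t ht)] at hmem
  refine hp ((Subgroup.eq_bot_iff_forall _).2 fun φ hφ => ?_)
  refine eq_one_of_fieldAut_fixes hB ht fun i => ?_
  obtain ⟨ζ, -, h⟩ := exists_fieldAut_smul φ (ht.var_mem i)
  have h1 : ρ φ ⟨t.var i, hR t ht i⟩ = ζ • ⟨t.var i, hR t ht i⟩ :=
    Subtype.ext (by rw [hρ, h]; rfl)
  have h2 : p (ρ φ ⟨t.var i, hR t ht i⟩) = p ⟨t.var i, hR t ht i⟩ := hφ _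
  rw [h1, map_smul, smul_eq_mul] at h2
  have h3 : ζ = 1 := mul_right_cancel₀ (hmem i) (by rw [h2, one_mul])
  rw [h, h3, one_smul]

end StabilizerSubsetDeep

/-! ### Sign automorphisms. -/

section Signs

/-- Rescaling the coordinate functions by signs. -/
noncomputable def polySign (c : Fin 3 ⊕ Fin m → ℂ) (hc : ∀ i, c i * c i = 1) :
    MvPolynomial (Fin 3 ⊕ Fin m) ℂ ≃ₐ[ℂ] MvPolynomial (Fin 3 ⊕ Fin m) ℂ :=
  AlgEquiv.ofAlgHom (aeval fun i => c i • X i) (aeval fun i => c i • X i)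
    (by
      ext1 i
      simp [smul_smul, hc])
    (by
      ext1 i
      simp [smul_smul, hc])

/-- Rescaling the coordinate functions of `ℱ` by signs. -/
noncomputable def fieldSign (c : Fin 3 ⊕ Fin m → ℂ) (hc : ∀ i, c i * c i = 1) :
    RatFun 3 m ≃ₐ[ℂ] RatFun 3 m :=
  IsFractionRing.fieldEquivOfAlgEquiv ℂ (RatFun 3 m) (RatFun 3 m) (polySign c hc)

theorem fieldSign_initialSeed (c : Fin 3 ⊕ Fin m → ℂ) (hc : ∀ i, c i * c i = 1) (i) :
    fieldSign c hc ((initialSeed B).var i) = c i • (initialSeed B).var i := by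
  have h := IsFractionRing.fieldEquivOfAlgEquiv_algebraMap ℂ (RatFun 3 m) (RatFun 3 m)
    (polySign c hc) (X i)
  have h2 : polySign c hc (X i) = c i • X i := by simp [polySign]
  rw [h2] at h
  refine h.trans ?_
  rw [Algebra.smul_def, map_mul,
    ← IsScalarTower.algebraMap_apply, ← Algebra.smul_def]
  rfl

/-- The sign vectors acting on the mutable directions only. -/
def extendSign (m : ℕ) (ε : Fin 3 → ℂ) : Fin 3 ⊕ Fin m → ℂ :=
  Sum.elim ε fun _ => 1

theorem extendSign_mul_self {ε : Fin 3 → ℂ} (hε : ∀ i, ε i * ε i = 1) (i : Fin 3 ⊕ Fin m) :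
    extendSign m ε i * extendSign m ε i = 1 := by
  rcases i with i | i <;> simp [extendSign, hε]

/-- The exchange numerator contains mutable variables only through squares and is therefore fixed;
the new variable inherits the sign of the one it replaces. -/
theorem IsSeed.fieldSign_var {s : Fin 3} (hB : Oriented B s) {ε : Fin 3 → ℂ}
    (hε : ∀ i, ε i * ε i = 1) {t : Seed 3 m} (ht : IsSeed B t) (i) :
    fieldSign (extendSign m ε) (extendSign_mul_self hε) (t.var i) =
      extendSign m ε i • t.var i := by
  induction ht generalizing i with
  | initial => exact fieldSign_initialSeed _ _ i
  | mutate t k ht ih =>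
    obtain ⟨s', h⟩ := ht.exists_oriented hB
    by_cases hi : i = Sum.inl k
    · subst hi
      have hfr : ∀ a, fieldSign (extendSign m ε) (extendSign_mul_self hε) (t.var (Sum.inr a)) =
          t.var (Sum.inr a) := fun a => by rw [ih, extendSign, Sum.elim_inr, one_smul]
      have hsq : ∀ j, fieldSign (extendSign m ε) (extendSign_mul_self hε)
          (t.var (Sum.inl j)) ^ 2 = t.var (Sum.inl j) ^ 2 := fun j => by
        rw [ih, extendSign, Sum.elim_inl, sq, smul_mul_smul_comm, hε, one_smul, sq]
      have hinv : (extendSign m ε (Sum.inl k))⁻¹ = extendSign m ε (Sum.inl k) :=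
        inv_eq_of_mul_eq_one_left (hε k)
      rw [t.mutate_var_self h k, map_mul, map_inv₀, map_add, map_mul, map_mul, map_pow, map_pow,
        hsq, hsq, Seed.posCoeff, Seed.negCoeff, map_prod, map_prod]
      simp only [map_pow, hfr]
      rw [ih, Algebra.smul_def, Algebra.smul_def, mul_inv, ← map_inv₀, hinv, mul_assoc]
    · rw [t.mutate_var_of_ne k hi, ih]

theorem fieldSign_mem_clusterAlgebra {s : Fin 3} (hB : Oriented B s) {ε : Fin 3 → ℂ}
    (hε : ∀ i, ε i * ε i = 1) {z : RatFun 3 m} (hz : z ∈ clusterAlgebra B) :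
    fieldSign (extendSign m ε) (extendSign_mul_self hε) z ∈ clusterAlgebra B := by
  suffices h : clusterAlgebra B ≤ (clusterAlgebra B).comap
      (AlgHomClass.toAlgHom (fieldSign (extendSign m ε) (extendSign_mul_self hε))) from h hz
  refine Algebra.adjoin_le ?_
  rintro z ((⟨t, ht, i, rfl⟩ | ⟨j, rfl⟩) | hz)
  · change fieldSign _ _ _ ∈ clusterAlgebra B
    rw [ht.fieldSign_var hB hε]
    exact Subalgebra.smul_mem _ (ht.var_mem_clusterAlgebra _) _
  · change fieldSign _ _ ((initialSeed B).var (Sum.inr j)) ∈ clusterAlgebra B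
    rw [IsSeed.initial.fieldSign_var hB hε]
    exact Subalgebra.smul_mem _ (IsSeed.initial.var_mem_clusterAlgebra _) _
  · change fieldSign _ _ z ∈ clusterAlgebra B
    obtain ⟨j, hj⟩ := hz
    have h1 : fieldSign (extendSign m ε) (extendSign_mul_self hε) z = z := by
      have := IsSeed.initial.fieldSign_var hB hε (Sum.inr j)
      simp only at hj
      rw [hj, map_inv₀, show extendSign m ε (Sum.inr j) = 1 from rfl, one_smul, inv_inj] at this
      exact this
    rw [h1]
    exact Algebra.subset_adjoin (Or.inr ⟨j, hj⟩)

theorem fieldSign_fieldSign (c : Fin 3 ⊕ Fin m → ℂ) (hc : ∀ i, c i * c i = 1) (z : RatFun 3 m) :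
    fieldSign c hc (fieldSign c hc z) = z := by
  have h : (AlgHomClass.toAlgHom (fieldSign c hc)).comp (AlgHomClass.toAlgHom (fieldSign c hc)) =
      AlgHom.id ℂ (RatFun 3 m) := by
    -- The initial variables do not depend on the matrix, so any oriented matrix may serve to see
    -- that they generate the field.
    refine (IsSeed.initial (B := Matrix.fromRows markovPrincipal 0)).algHom_ext
      (s := 1) ⟨by decide, fun k => ?_⟩ fun i => ?_
    · fin_cases k <;> simp [markovPrincipal]
    · change fieldSign c hc (fieldSign c hc _) = _
      rw [fieldSign_initialSeed, Algebra.smul_def, map_mul, AlgEquiv.commutes,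
        fieldSign_initialSeed, ← Algebra.smul_def, smul_smul, hc, one_smul]
      rfl
  exact DFunLike.congr_fun h z

/-- The cluster automorphism given by a sign vector on the mutable directions. -/
noncomputable def signAut {s : Fin 3} (hB : Oriented B s) (ε : Fin 3 → ℂ)
    (hε : ∀ i, ε i * ε i = 1) : clusterAut B :=
  ⟨AlgEquiv.ofAlgHom
    (((fieldSign (extendSign m ε) (extendSign_mul_self hε) : RatFun 3 m →ₐ[ℂ] RatFun 3 m).comp
      (clusterAlgebra B).val).codRestrict (clusterAlgebra B)
        fun z => fieldSign_mem_clusterAlgebra hB hε z.2)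
    (((fieldSign (extendSign m ε) (extendSign_mul_self hε) : RatFun 3 m →ₐ[ℂ] RatFun 3 m).comp
      (clusterAlgebra B).val).codRestrict (clusterAlgebra B)
        fun z => fieldSign_mem_clusterAlgebra hB hε z.2)
    (AlgHom.ext fun z => Subtype.ext (fieldSign_fieldSign _ _ _))
    (AlgHom.ext fun z => Subtype.ext (fieldSign_fieldSign _ _ _)), by
    rintro ⟨z, hzA⟩ hz
    have hne : ∀ i, extendSign m ε i ≠ 0 := fun i h => by
      simpa [h] using extendSign_mul_self (m := m) hε i
    rcases hz with ⟨t, ht, i, rfl⟩ | ⟨j, rfl⟩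
    · exact ⟨_, hne (Sum.inl i), Subtype.ext (ht.fieldSign_var hB hε _)⟩
    · exact ⟨_, hne (Sum.inr j), Subtype.ext (IsSeed.initial.fieldSign_var hB hε _)⟩⟩

theorem fieldAut_signAut {s : Fin 3} (hB : Oriented B s) {ε : Fin 3 → ℂ}
    (hε : ∀ i, ε i * ε i = 1) (z : RatFun 3 m) :
    fieldAut B (signAut hB ε hε) z =
      fieldSign (extendSign m ε) (extendSign_mul_self hε) z := by
  have : AlgHomClass.toAlgHom (fieldAut B (signAut hB ε hε)) =
      AlgHomClass.toAlgHom (fieldSign (extendSign m ε) (extendSign_mul_self hε)) := by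
    refine IsSeed.initial.algHom_ext hB fun i => ?_
    exact fieldAut_coe (signAut hB ε hε)
      ⟨(initialSeed B).var i, IsSeed.initial.var_mem_clusterAlgebra i⟩
  exact DFunLike.congr_fun this z

theorem signAut_ne_one {s : Fin 3} (hB : Oriented B s) {ε : Fin 3 → ℂ}
    (hε : ∀ i, ε i * ε i = 1) {i : Fin 3} (hi : ε i ≠ 1) : signAut hB ε hε ≠ 1 := by
  intro h
  have h1 := fieldAut_signAut hB hε ((initialSeed B).var (Sum.inl i))
  rw [h, map_one, AlgEquiv.one_apply, IsSeed.initial.fieldSign_var hB hε, extendSign,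
    Sum.elim_inl] at h1
  refine hi ?_
  have h2 : (ε i - 1) • (initialSeed B).var (Sum.inl i) = 0 := by
    rw [sub_smul, one_smul, ← h1, sub_self]
  exact sub_eq_zero.1 ((smul_eq_zero.1 h2).resolve_right (IsSeed.initial.var_ne_zero hB _))

end Signs

/-! ### Values of the cluster variables at deep points; the cluster algebra has no mysterious
points. -/

section DeepPoints

variable {R : Subalgebra ℂ (RatFun 3 m)}

theorem IsSeed.point_frozen_ne_zero {t : Seed 3 m} (ht : IsSeed B t)
    (hR : ∀ t : Seed 3 m, IsSeed B t → ∀ i, t.var i ∈ R)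
    (hF : ∀ j, ((initialSeed B).var (Sum.inr j))⁻¹ ∈ R) (p : Points R) (j : Fin m) :
    p ⟨t.var (Sum.inr j), hR t ht _⟩ ≠ 0 := by
  intro h
  have h0 : (initialSeed B).var (Sum.inr j) ≠ 0 := by
    simp [initialSeed]
  have h1 : (⟨t.var (Sum.inr j), hR t ht _⟩ : R) * ⟨_, hF j⟩ = 1 :=
    Subtype.ext (by simp only [MulMemClass.coe_mul, ht.var_inr]; exact mul_inv_cancel₀ h0)
  have h2 := congrArg p h1
  rw [map_mul, h, zero_mul, map_one] at h2
  exact zero_ne_one h2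

theorem IsSeed.point_exchange {s : Fin 3} (hB : Oriented B s) {t : Seed 3 m} (ht : IsSeed B t)
    (hR : ∀ t : Seed 3 m, IsSeed B t → ∀ i, t.var i ∈ R)
    (hF : ∀ j, ((initialSeed B).var (Sum.inr j))⁻¹ ∈ R) (p : Points R)
    {s' : Fin 3} (h : Oriented t.mat s') (k : Fin 3) :
    ∃ a b : ℂ, a ≠ 0 ∧ b ≠ 0 ∧
      p ⟨t.var (Sum.inl k), hR t ht _⟩ *
        p ⟨(t.mutate k).var (Sum.inl k), hR _ (ht.mutate t k) _⟩ =
      a * p ⟨t.var (Sum.inl (k + s')), hR t ht _⟩ ^ 2 +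
        b * p ⟨t.var (Sum.inl (k - s')), hR t ht _⟩ ^ 2 := by
  refine ⟨∏ a, p ⟨t.var (Sum.inr a), hR t ht _⟩ ^ (t.mat (Sum.inr a) k).toNat,
    ∏ a, p ⟨t.var (Sum.inr a), hR t ht _⟩ ^ (-t.mat (Sum.inr a) k).toNat,
    Finset.prod_ne_zero_iff.2 fun a _ => pow_ne_zero _ (ht.point_frozen_ne_zero hR hF p a),
    Finset.prod_ne_zero_iff.2 fun a _ => pow_ne_zero _ (ht.point_frozen_ne_zero hR hF p a), ?_⟩
  simp only [← map_pow, ← map_prod, ← map_mul, ← map_add]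
  congr 1
  apply Subtype.ext
  simp only [MulMemClass.coe_mul, AddMemClass.coe_add, SubmonoidClass.coe_pow,
    SubmonoidClass.coe_finsetProd]
  exact ht.exchange hB h k

/-- If a point annihilates one cluster, then it annihilates all clusters. -/
theorem IsSeed.point_eq_zero {s : Fin 3} (hB : Oriented B s)
    (hR : ∀ t : Seed 3 m, IsSeed B t → ∀ i, t.var i ∈ R)
    (hF : ∀ j, ((initialSeed B).var (Sum.inr j))⁻¹ ∈ R) (p : Points R)
    (h0 : ∀ j, p ⟨(initialSeed B).var (Sum.inl j), hR _ IsSeed.initial _⟩ = 0)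
    {t : Seed 3 m} (ht : IsSeed B t) (j : Fin 3) :
    p ⟨t.var (Sum.inl j), hR t ht _⟩ = 0 := by
  induction ht generalizing j with
  | initial => exact h0 j
  | mutate t k ht ih =>
    obtain ⟨s', h⟩ := ht.exists_oriented hB
    have hne : ∀ i, i ≠ k → p ⟨(t.mutate k).var (Sum.inl i), hR _ (ht.mutate t k) _⟩ = 0 := by
      intro i hi
      rw [← ih i]
      congr 2
      exact t.mutate_var_of_ne k (by simpa using hi)
    by_cases hj : j = k
    · subst hj
      have h' := h.mutate j
      -- The relation in direction `j` says nothing about the new variable. In direction `j + s'`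
      -- the left side vanishes and the right side is `a` times the square of the new variable plus
      -- a vanishing term.
      obtain ⟨a, b, ha, hb, hab⟩ := (ht.mutate t j).point_exchange hB hR hF p h' (j + s')
      rw [hne _ (fin_three_add_ne h.1 j), zero_mul, ← sub_eq_add_neg, add_sub_cancel_right,
        sub_neg_eq_add, fin_three_add_add, hne _ (fin_three_sub_ne h.1 j)] at hab
      simpa [ha] using hab.symm
    · exact hne j hj

/-- The cluster variables at a deep point: either all of them vanish, or there is a mutable
direction such that exactly the cluster variables in this direction vanish. -/
theorem deepLocus_dichotomy {s : Fin 3} (hB : Oriented B s)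
    (hR : ∀ t : Seed 3 m, IsSeed B t → ∀ i, t.var i ∈ R)
    (hF : ∀ j, ((initialSeed B).var (Sum.inr j))⁻¹ ∈ R) {p : Points R}
    (hp : p ∈ deepLocus B R) :
    (∀ (t : Seed 3 m) (ht : IsSeed B t) (j : Fin 3), p ⟨t.var (Sum.inl j), hR t ht _⟩ = 0) ∨
    ∃ i : Fin 3, ∀ (t : Seed 3 m) (ht : IsSeed B t),
      p ⟨t.var (Sum.inl i), hR t ht _⟩ = 0 ∧
      ∀ j, j ≠ i → p ⟨t.var (Sum.inl j), hR t ht _⟩ ≠ 0 := by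
  have hdeep : ∀ (t : Seed 3 m) (ht : IsSeed B t), ∃ i, p ⟨t.var (Sum.inl i), hR t ht _⟩ = 0 := by
    intro t ht
    have h := hp t ht
    rw [mem_clusterTorus_iff (ht.algebraicIndependent hB) (hR t ht)] at h
    push Not at h
    obtain ⟨i | j, h⟩ := h
    · exact ⟨i, h⟩
    · exact absurd h (ht.point_frozen_ne_zero hR hF p j)
  obtain ⟨i, hi⟩ := hdeep _ IsSeed.initial
  obtain ⟨a, b, ha, hb, hab⟩ := IsSeed.initial.point_exchange hB hR hF p hB i
  rw [hi, zero_mul] at hab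
  -- Two squares with nonzero coefficients sum to zero, so the other two variables vanish together
  -- or not at all.
  by_cases h1 : p ⟨(initialSeed B).var (Sum.inl (i + s)), hR _ IsSeed.initial _⟩ = 0
  · left
    have h2 : p ⟨(initialSeed B).var (Sum.inl (i - s)), hR _ IsSeed.initial _⟩ = 0 := by
      rw [h1] at hab
      simpa [hb] using hab.symm
    intro t ht j
    refine ht.point_eq_zero hB hR hF p (fun j => ?_) j
    rcases eq_or_cyclic j i hB.1 with rfl | rfl | rfl
    exacts [hi, h1, h2]
  · right
    have h2 : p ⟨(initialSeed B).var (Sum.inl (i - s)), hR _ IsSeed.initial _⟩ ≠ 0 := by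
      intro h2
      rw [h2] at hab
      exact h1 (by simpa [ha] using hab.symm)
    refine ⟨i, fun t ht => ?_⟩
    induction ht with
    | initial =>
      refine ⟨hi, fun j hj => ?_⟩
      rcases eq_or_cyclic j i hB.1 with rfl | rfl | rfl
      exacts [absurd rfl hj, h1, h2]
    | mutate t k ht ih =>
      have heq : ∀ i, i ≠ k → p ⟨(t.mutate k).var (Sum.inl i), hR _ (ht.mutate t k) _⟩ =
          p ⟨t.var (Sum.inl i), hR _ ht _⟩ := by
        intro i hi
        congr 2
        exact t.mutate_var_of_ne k (by simpa using hi)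
      obtain ⟨ih0, ihne⟩ := ih
      by_cases hik : i = k
      · subst hik
        have hne : ∀ j, j ≠ i →
            p ⟨(t.mutate i).var (Sum.inl j), hR _ (ht.mutate t i) _⟩ ≠ 0 := by
          intro j hj
          rw [heq j hj]
          exact ihne j hj
        refine ⟨?_, hne⟩
        -- The exchange relation does not determine the new variable in direction `i`. Its vanishing
        -- comes from deepness: some variable of the new cluster vanishes and the other two do not.
        obtain ⟨j, hj⟩ := hdeep _ (ht.mutate t i)
        by_cases hji : j = i
        · rwa [hji] at hj
        · exact absurd hj (hne j hji)
      · refine ⟨by rw [heq i hik]; exact ih0, fun j hj => ?_⟩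
        by_cases hjk : j = k
        · subst hjk
          -- Exactly one of the two squares in the exchange numerator is zero, so the product of old
          -- and new variable is nonzero.
          obtain ⟨s', h⟩ := ht.exists_oriented hB
          obtain ⟨a, b, ha, hb, hab⟩ := ht.point_exchange hB hR hF p h j
          intro h0
          rw [h0, mul_zero] at hab
          rcases eq_or_cyclic i j h.1 with h3 | h3 | h3
          · exact hik h3
          · rw [← h3, ih0] at hab
            have := ihne (j - s') (by rw [h3]; exact fin_three_sub_ne_add h.1 j)
            simp [hb, this] at hab
          · rw [← h3, ih0] at hab
            have := ihne (j + s') (by rw [h3]; exact (fin_three_sub_ne_add h.1 j).symm)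
            simp [ha, this] at hab
        · rw [heq j hjk]
          exact ihne j hj

/-- The sign vector with a single sign. -/
def singleSign (i : Fin 3) : Fin 3 → ℂ := fun j => if j = i then -1 else 1

theorem singleSign_mul_self (i j : Fin 3) : singleSign i j * singleSign i j = 1 := by
  unfold singleSign
  split_ifs <;> simp

theorem frozen_inv_mem_clusterAlgebra (j : Fin m) :
    ((initialSeed B).var (Sum.inr j))⁻¹ ∈ clusterAlgebra B :=
  Algebra.subset_adjoin (Or.inr ⟨j, (inv_inv _).symm⟩)

/-- One direction whose variables vanish in all seeds is enough: the sign in that direction moves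
only generators of value zero. -/
theorem clusterHasNoMysteriousPoints_of_oriented {s : Fin 3} (hB : Oriented B s) :
    ClusterHasNoMysteriousPoints B := by
  have hR : ∀ t : Seed 3 m, IsSeed B t → ∀ i, t.var i ∈ clusterAlgebra B :=
    fun t ht i => ht.var_mem_clusterAlgebra i
  refine Set.Subset.antisymm
    (stabilizerLocus_subset_deepLocus hB hR isRestrictedAction_clusterAction) fun p hp => ?_
  obtain ⟨i, hi⟩ : ∃ i : Fin 3, ∀ (t : Seed 3 m) (ht : IsSeed B t),
      p ⟨t.var (Sum.inl i), hR t ht _⟩ = 0 := by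
    rcases deepLocus_dichotomy hB hR frozen_inv_mem_clusterAlgebra hp with h | ⟨i, h⟩
    · exact ⟨0, fun t ht => h t ht 0⟩
    · exact ⟨i, fun t ht => (h t ht).1⟩
  intro hbot
  refine signAut_ne_one hB (singleSign_mul_self i) (i := i)
    (by simp only [singleSign, if_true]; norm_num)
    ((Subgroup.eq_bot_iff_forall _).1 hbot _ ?_)
  rintro ⟨r, hr⟩
  let σ := signAut hB (singleSign i) (singleSign_mul_self i)
  have hσ : ∀ (z : RatFun 3 m) (hz : z ∈ clusterAlgebra B),
      ((clusterAction B σ ⟨z, hz⟩ : clusterAlgebra B) : RatFun 3 m) =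
        fieldSign (extendSign m (singleSign i)) (extendSign_mul_self (singleSign_mul_self i)) z :=
    fun z hz => rfl
  change p (clusterAction B σ ⟨r, hr⟩) = p ⟨r, hr⟩
  have hfix : ∀ z (hz : z ∈ clusterAlgebra B),
      fieldSign (extendSign m (singleSign i)) (extendSign_mul_self (singleSign_mul_self i)) z = z →
      p (clusterAction B σ ⟨z, hz⟩) = p ⟨z, hz⟩ := fun z hz h => by
    congr 1
    exact Subtype.ext ((hσ z hz).trans h)
  induction hr using Algebra.adjoin_induction with
  | mem z hz =>
    rcases hz with (⟨t, ht, j, rfl⟩ | ⟨j, rfl⟩) | hz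
    · by_cases hj : j = i
      · subst hj
        have h1 : clusterAction B σ ⟨t.var (Sum.inl j), hR t ht _⟩ =
            singleSign j j • ⟨t.var (Sum.inl j), hR t ht _⟩ :=
          Subtype.ext (ht.fieldSign_var hB (singleSign_mul_self j) _)
        rw [h1, map_smul, hi t ht, smul_zero]
      · refine hfix _ _ ?_
        rw [ht.fieldSign_var hB (singleSign_mul_self i), extendSign, Sum.elim_inl,
          singleSign, if_neg hj, one_smul]
    · refine hfix _ _ ?_
      rw [IsSeed.initial.fieldSign_var hB (singleSign_mul_self i), extendSign,
        Sum.elim_inr, one_smul]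
    · obtain ⟨j, hj⟩ := hz
      refine hfix _ _ ?_
      rw [← inv_inv z, ← hj, map_inv₀, IsSeed.initial.fieldSign_var hB (singleSign_mul_self i),
        extendSign, Sum.elim_inr, one_smul]
  | algebraMap a =>
    exact hfix _ _ (AlgEquiv.commutes _ a)
  | add x y hx hy h1 h2 =>
    change p (clusterAction B σ (⟨x, hx⟩ + ⟨y, hy⟩)) = p (⟨x, hx⟩ + ⟨y, hy⟩)
    rw [map_add, map_add, map_add, h1, h2]
  | mul x y hx hy h1 h2 =>
    change p (clusterAction B σ (⟨x, hx⟩ * ⟨y, hy⟩)) = p (⟨x, hx⟩ * ⟨y, hy⟩)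
    rw [map_mul, map_mul, map_mul, h1, h2]

theorem oriented_markovMatrix : Oriented markovMatrix 1 := by
  refine ⟨by decide, fun k => ?_⟩
  fin_cases k <;> simp [markovMatrix, markovPrincipal]

theorem oriented_markovPrinMatrix : Oriented markovPrinMatrix 1 := by
  refine ⟨by decide, fun k => ?_⟩
  fin_cases k <;> simp [markovPrinMatrix, markovPrincipal]

end DeepPoints

end ClusterAlg

namespace ClusterAlg

/-! ### Arcs, loops and notched arcs of the once-punctured torus under a flip. -/

section MarkovTriple

variable {F : Type*} [Field F]

/-- The closed loop disjoint from the arc `x₁`, in a triangulation `x₁, x₂, x₃` of the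
once-punctured torus with coefficients `u₁, u₂, u₃`. -/
def loopElt (x₁ x₂ x₃ u₂ u₃ : F) : F :=
  (x₂ ^ 2 + u₃ * x₁ ^ 2 + u₂ * u₃ * x₃ ^ 2) / (x₂ * x₃)

/-- The notched version of the arc `x₁` in a triangulation `x₁, x₂, x₃` of the once-punctured torus
with coefficients `u₁, u₂, u₃`. -/
def notchedElt (x₁ x₂ x₃ u₁ u₂ u₃ : F) : F :=
  (u₁ * loopElt x₁ x₂ x₃ u₂ u₃ ^ 2 + (1 - u₁ * u₂ * u₃) ^ 2) / x₁

variable {x₁ x₂ x₃ u₁ u₂ u₃ : F}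

/-- A skein relation with coefficients. This is the only loop that a flip changes by more than a
monomial, and it stays polynomial in the old loops. -/
theorem loopElt_flip₁ (h1 : x₁ ≠ 0) (h2 : x₂ ≠ 0) (h3 : x₃ ≠ 0) :
    loopElt ((u₁ * x₂ ^ 2 + x₃ ^ 2) / x₁) x₃ x₂ (u₃ * u₁ ^ 2) u₂ =
      loopElt x₂ x₃ x₁ u₃ u₁ * loopElt x₃ x₁ x₂ u₁ u₂ - u₁ * loopElt x₁ x₂ x₃ u₂ u₃ := by
  simp only [loopElt]
  field_simp
  ring

theorem loopElt_flip₂ (h1 : x₁ ≠ 0) (h2 : x₂ ≠ 0) (hP : u₁ * x₂ ^ 2 + x₃ ^ 2 ≠ 0)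
    (hu : u₁ ≠ 0) :
    loopElt x₃ x₂ ((u₁ * x₂ ^ 2 + x₃ ^ 2) / x₁) u₂ u₁⁻¹ =
      u₁⁻¹ * loopElt x₃ x₁ x₂ u₁ u₂ := by
  -- The flipped arc also occurs in a denominator; it is kept as a variable `e` subject to `e * x₁ =
  -- u₁ * x₂ ^ 2 + x₃ ^ 2`.
  obtain ⟨e, he⟩ : ∃ e, e = (u₁ * x₂ ^ 2 + x₃ ^ 2) / x₁ := ⟨_, rfl⟩
  have he0 : e ≠ 0 := he ▸ div_ne_zero hP h1
  rw [eq_div_iff h1] at he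
  rw [← (eq_div_iff h1).2 he]
  simp only [loopElt]
  field_simp
  linear_combination (u₂ * e - x₁) * he

theorem loopElt_flip₃ (h1 : x₁ ≠ 0) (h3 : x₃ ≠ 0) (hP : u₁ * x₂ ^ 2 + x₃ ^ 2 ≠ 0) :
    loopElt x₂ ((u₁ * x₂ ^ 2 + x₃ ^ 2) / x₁) x₃ u₁⁻¹ (u₃ * u₁ ^ 2) =
      loopElt x₂ x₃ x₁ u₃ u₁ := by
  simp only [loopElt]
  field_simp
  ring

/-- With a loop available, the division in the exchange relation disappears. -/
theorem flip_eq (h1 : x₁ ≠ 0) (h3 : x₃ ≠ 0) :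
    (u₁ * x₂ ^ 2 + x₃ ^ 2) / x₁ = loopElt x₂ x₃ x₁ u₃ u₁ * x₃ - u₃ * u₁ * x₁ := by
  simp only [loopElt]
  field_simp
  ring

/-- The notched counterpart of `flip_eq`, up to a monomial in the coefficients. -/
theorem notchedElt_flip₁ (h1 : x₁ ≠ 0) (h2 : x₂ ≠ 0) (h3 : x₃ ≠ 0)
    (hP : u₁ * x₂ ^ 2 + x₃ ^ 2 ≠ 0) (hu : u₁ ≠ 0) (hu₃ : u₃ ≠ 0) :
    notchedElt ((u₁ * x₂ ^ 2 + x₃ ^ 2) / x₁) x₃ x₂ u₁⁻¹ (u₃ * u₁ ^ 2) u₂ =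
      u₁⁻¹ * u₃⁻¹ * (loopElt x₂ x₃ x₁ u₃ u₁ * notchedElt x₃ x₁ x₂ u₃ u₁ u₂ -
        notchedElt x₁ x₂ x₃ u₁ u₂ u₃) := by
  rw [notchedElt, loopElt_flip₁ h1 h2 h3]
  simp only [notchedElt, loopElt]
  field_simp
  ring

variable [Algebra ℂ F]

/-- `S` contains the arcs, the loops and the notched arcs of a triangulation. -/
structure ContainsTriple (S : Subalgebra ℂ F) (x₁ x₂ x₃ u₁ u₂ u₃ : F) : Prop where
  arc₁ : x₁ ∈ S
  arc₂ : x₂ ∈ S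
  arc₃ : x₃ ∈ S
  loop₁ : loopElt x₁ x₂ x₃ u₂ u₃ ∈ S
  loop₂ : loopElt x₂ x₃ x₁ u₃ u₁ ∈ S
  loop₃ : loopElt x₃ x₁ x₂ u₁ u₂ ∈ S
  notched₁ : notchedElt x₁ x₂ x₃ u₁ u₂ u₃ ∈ S
  notched₂ : notchedElt x₂ x₃ x₁ u₂ u₃ u₁ ∈ S
  notched₃ : notchedElt x₃ x₁ x₂ u₃ u₁ u₂ ∈ S

variable {S : Subalgebra ℂ F}

theorem ContainsTriple.rotate (h : ContainsTriple S x₁ x₂ x₃ u₁ u₂ u₃) :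
    ContainsTriple S x₂ x₃ x₁ u₂ u₃ u₁ :=
  ⟨h.arc₂, h.arc₃, h.arc₁, h.loop₂, h.loop₃, h.loop₁, h.notched₂, h.notched₃, h.notched₁⟩

/-- The flip uses the numerator `u₁ * x₂ ^ 2 + x₃ ^ 2` with a Laurent monomial `u₁`, whereas
mutation clears negative exponents. The two differ by the factor `negCoeff`, which this rescaling
supplies. -/
theorem ContainsTriple.scale (h : ContainsTriple S x₁ x₂ x₃ u₁ u₂ u₃) {c : F} (hc : c ≠ 0)
    (hcS : c ∈ S) (hcS' : c⁻¹ ∈ S) :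
    ContainsTriple S (c * x₁) x₂ x₃ u₁ (u₂ * c ^ 2) (u₃ * (c ^ 2)⁻¹) := by
  have l1 : loopElt (c * x₁) x₂ x₃ (u₂ * c ^ 2) (u₃ * (c ^ 2)⁻¹) = loopElt x₁ x₂ x₃ u₂ u₃ := by
    simp only [loopElt]
    field_simp
  have l2 : loopElt x₂ x₃ (c * x₁) (u₃ * (c ^ 2)⁻¹) u₁ = c⁻¹ * loopElt x₂ x₃ x₁ u₃ u₁ := by
    simp only [loopElt]
    field_simp
  have l3 : loopElt x₃ (c * x₁) x₂ u₁ (u₂ * c ^ 2) = c⁻¹ * (c ^ 2 * loopElt x₃ x₁ x₂ u₁ u₂) := by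
    simp only [loopElt]
    field_simp
  refine ⟨mul_mem hcS h.arc₁, h.arc₂, h.arc₃, l1 ▸ h.loop₁, l2 ▸ mul_mem hcS' h.loop₂,
    l3 ▸ mul_mem hcS' (mul_mem (pow_mem hcS 2) h.loop₃), ?_, ?_, ?_⟩
  · have : notchedElt (c * x₁) x₂ x₃ u₁ (u₂ * c ^ 2) (u₃ * (c ^ 2)⁻¹) =
        c⁻¹ * notchedElt x₁ x₂ x₃ u₁ u₂ u₃ := by
      rw [notchedElt, l1, notchedElt]
      field_simp
    exact this ▸ mul_mem hcS' h.notched₁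
  · have : notchedElt x₂ x₃ (c * x₁) (u₂ * c ^ 2) (u₃ * (c ^ 2)⁻¹) u₁ =
        notchedElt x₂ x₃ x₁ u₂ u₃ u₁ := by
      rw [notchedElt, l2, notchedElt]
      field_simp
    exact this ▸ h.notched₂
  · have : notchedElt x₃ (c * x₁) x₂ (u₃ * (c ^ 2)⁻¹) u₁ (u₂ * c ^ 2) =
        notchedElt x₃ x₁ x₂ u₃ u₁ u₂ := by
      rw [notchedElt, l3, notchedElt]
      field_simp
    exact this ▸ h.notched₃

theorem ContainsTriple.flip (h : ContainsTriple S x₁ x₂ x₃ u₁ u₂ u₃)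
    (h1 : x₁ ≠ 0) (h2 : x₂ ≠ 0) (h3 : x₃ ≠ 0) (hP : u₁ * x₂ ^ 2 + x₃ ^ 2 ≠ 0)
    (hu₁ : u₁ ≠ 0) (hu₃ : u₃ ≠ 0)
    (m₁ : u₁ ∈ S) (m₁' : u₁⁻¹ ∈ S) (m₃ : u₃ ∈ S) (m₃' : u₃⁻¹ ∈ S) :
    ContainsTriple S ((u₁ * x₂ ^ 2 + x₃ ^ 2) / x₁) x₃ x₂ u₁⁻¹ (u₃ * u₁ ^ 2) u₂ where
  arc₁ := by
    rw [flip_eq (u₃ := u₃) h1 h3]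
    exact sub_mem (mul_mem h.loop₂ h.arc₃) (mul_mem (mul_mem m₃ m₁) h.arc₁)
  arc₂ := h.arc₃
  arc₃ := h.arc₂
  loop₁ := by
    rw [loopElt_flip₁ h1 h2 h3]
    exact sub_mem (mul_mem h.loop₂ h.loop₃) (mul_mem m₁ h.loop₁)
  loop₂ := by
    rw [loopElt_flip₂ h1 h2 hP hu₁]
    exact mul_mem m₁' h.loop₃
  loop₃ := by
    rw [loopElt_flip₃ h1 h3 hP]
    exact h.loop₂
  notched₁ := by
    rw [notchedElt_flip₁ h1 h2 h3 hP hu₁ hu₃]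
    exact mul_mem (mul_mem m₁' m₃') (sub_mem (mul_mem h.loop₂ h.notched₃) h.notched₁)
  notched₂ := by
    have : notchedElt x₃ x₂ ((u₁ * x₂ ^ 2 + x₃ ^ 2) / x₁) (u₃ * u₁ ^ 2) u₂ u₁⁻¹ =
        notchedElt x₃ x₁ x₂ u₃ u₁ u₂ := by
      rw [notchedElt, loopElt_flip₂ h1 h2 hP hu₁, notchedElt]
      field_simp
    rw [this]
    exact h.notched₃
  notched₃ := by
    have : notchedElt x₂ ((u₁ * x₂ ^ 2 + x₃ ^ 2) / x₁) x₃ u₂ u₁⁻¹ (u₃ * u₁ ^ 2) =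
        notchedElt x₂ x₃ x₁ u₂ u₃ u₁ := by
      rw [notchedElt, loopElt_flip₃ h1 h3 hP, notchedElt]
      field_simp
    rw [this]
    exact h.notched₂

end MarkovTriple

/-! ### Mutation invariance and the Laurent phenomenon. -/

section LaurentPhenomenon

variable {m : ℕ} {B : Matrix (Fin 3 ⊕ Fin m) (Fin 3) ℤ}

theorem mutateMatrix_mutateMatrix {n : ℕ} (M : Matrix (Fin n ⊕ Fin m) (Fin n) ℤ) (k : Fin n) :
    mutateMatrix (mutateMatrix M k) k = M := by
  ext i j
  by_cases h : i = Sum.inl k ∨ j = k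
  · simp [mutateMatrix, h]
  · have hj : j ≠ k := fun h' => h (Or.inr h')
    have hi : i ≠ Sum.inl k := fun h' => h (Or.inl h')
    simp [mutateMatrix, hi, hj]

/-- Involutivity upgrades the implication `IsSeed.containsSeed_mutate` to an equivalence. -/
theorem IsSeed.mutate_mutate {s : Fin 3} (hB : Oriented B s) {t : Seed 3 m} (ht : IsSeed B t)
    (k : Fin 3) : (t.mutate k).mutate k = t := by
  obtain ⟨s', h⟩ := ht.exists_oriented hB
  apply Seed.ext
  · funext i
    by_cases hi : i = Sum.inl k
    · subst hi
      have h0 := (ht.mutate t k).var_ne_zero hB (Sum.inl k)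
      have h1 := (ht.mutate t k).exchange hB (h.mutate k) k
      have h2 := ht.exchange hB h k
      refine mul_left_cancel₀ h0 ?_
      rw [h1, mul_comm _ (t.var (Sum.inl k)), h2]
      have hp : (t.mutate k).posCoeff k = t.negCoeff k := by
        simp only [Seed.posCoeff, Seed.negCoeff]
        simp [Seed.mutate, mutateMatrix]
      have hn : (t.mutate k).negCoeff k = t.posCoeff k := by
        simp only [Seed.posCoeff, Seed.negCoeff]
        simp [Seed.mutate, mutateMatrix]
      rw [hp, hn, ← sub_eq_add_neg, sub_neg_eq_add,
        t.mutate_var_of_ne k (by simpa using fin_three_add_ne h.1 k),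
        t.mutate_var_of_ne k (by simpa using fin_three_sub_ne h.1 k), add_comm]
    · rw [Seed.mutate_var_of_ne _ k hi, Seed.mutate_var_of_ne _ k hi]
  · exact mutateMatrix_mutateMatrix _ k

/-- `S` contains the arcs, the loops and the notched arcs of the seed `t` of orientation `s`. -/
def ContainsSeed (S : Subalgebra ℂ (RatFun 3 m)) (t : Seed 3 m) (s : Fin 3) : Prop :=
  ∀ k, ContainsTriple S (t.var (Sum.inl k)) (t.var (Sum.inl (k + s))) (t.var (Sum.inl (k - s)))
    (t.coeff k) (t.coeff (k + s)) (t.coeff (k - s))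

theorem containsSeed_of_containsTriple {S : Subalgebra ℂ (RatFun 3 m)} {t : Seed 3 m} {s : Fin 3}
    (hs : s ≠ 0) {k : Fin 3} (h : ContainsTriple S (t.var (Sum.inl k)) (t.var (Sum.inl (k + s)))
      (t.var (Sum.inl (k - s))) (t.coeff k) (t.coeff (k + s)) (t.coeff (k - s))) :
    ContainsSeed S t s := by
  intro j
  rcases eq_or_cyclic j k hs with rfl | rfl | rfl
  · exact h
  · rw [fin_three_add_add, add_sub_cancel_right]
    exact h.rotate
  · rw [sub_add_cancel, fin_three_sub_sub]
    exact h.rotate.rotate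

theorem IsSeed.frozen_ne_zero {t : Seed 3 m} (ht : IsSeed B t) (j : Fin m) :
    t.var (Sum.inr j) ≠ 0 := by
  rw [ht.var_inr]
  simp [initialSeed]

/-- Since `posCoeff` is `coeff * negCoeff`, these are the coefficients produced by
`ContainsTriple.flip` followed by `ContainsTriple.scale` with `c = negCoeff`. -/
theorem IsSeed.coeff_mutate {t : Seed 3 m} (ht : IsSeed B t) {s : Fin 3} (h : Oriented t.mat s)
    (k : Fin 3) : (t.mutate k).coeff k = (t.coeff k)⁻¹ ∧
      (t.mutate k).coeff (k + s) = t.coeff (k + s) * (t.negCoeff k ^ 2)⁻¹ ∧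
      (t.mutate k).coeff (k - s) = t.coeff (k - s) * t.posCoeff k ^ 2 := by
  have hy := fun j => ht.frozen_ne_zero j
  have hv : ∀ a, (t.mutate k).var (Sum.inr a) = t.var (Sum.inr a) :=
    fun a => t.mutate_var_of_ne k (by simp)
  simp only [Seed.coeff, Seed.negCoeff, Seed.posCoeff, hv, ← Finset.prod_pow,
    ← Finset.prod_inv_distrib, ← Finset.prod_mul_distrib]
  refine ⟨Finset.prod_congr rfl fun a _ => ?_, Finset.prod_congr rfl fun a _ => ?_,
    Finset.prod_congr rfl fun a _ => ?_⟩
  · rw [show (t.mutate k).mat (Sum.inr a) k = _ from (h.mutate_frozen k a).1, zpow_neg]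
  · rw [show (t.mutate k).mat (Sum.inr a) (k + s) = _ from (h.mutate_frozen k a).2.1,
      ← pow_mul, ← zpow_natCast, ← zpow_neg, ← zpow_add₀ (hy a)]
    congr 1
    push_cast
    rw [Int.toNat_eq_max]
    ring
  · rw [show (t.mutate k).mat (Sum.inr a) (k - s) = _ from (h.mutate_frozen k a).2.2,
      ← pow_mul, ← zpow_natCast, ← zpow_add₀ (hy a)]
    congr 1
    push_cast
    rw [Int.toNat_eq_max]
    ring

theorem IsSeed.posCoeff_eq {t : Seed 3 m} (ht : IsSeed B t) (k : Fin 3) :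
    t.posCoeff k = t.coeff k * t.negCoeff k := by
  have hy := fun j => ht.frozen_ne_zero j
  simp only [Seed.coeff, Seed.negCoeff, Seed.posCoeff, ← Finset.prod_mul_distrib]
  refine Finset.prod_congr rfl fun a _ => ?_
  rw [← zpow_natCast, ← zpow_natCast, ← zpow_add₀ (hy a)]
  congr 1
  omega

theorem IsSeed.containsSeed_mutate {s₀ : Fin 3} (hB : Oriented B s₀) {t : Seed 3 m}
    (ht : IsSeed B t) {s : Fin 3} (hs : Oriented t.mat s) {S : Subalgebra ℂ (RatFun 3 m)}
    (hS : ∀ j, (initialSeed B).var (Sum.inr j) ∈ S)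
    (hS' : ∀ j, ((initialSeed B).var (Sum.inr j))⁻¹ ∈ S)
    (h : ContainsSeed S t s) (k : Fin 3) : ContainsSeed S (t.mutate k) (-s) := by
  have hy := fun j => ht.frozen_ne_zero j
  have hyS : ∀ j, t.var (Sum.inr j) ∈ S := fun j => by rw [ht.var_inr]; exact hS j
  have hyS' : ∀ j, (t.var (Sum.inr j))⁻¹ ∈ S := fun j => by rw [ht.var_inr]; exact hS' j
  have hz : ∀ j (a : ℤ), t.var (Sum.inr j) ^ a ∈ S := by
    intro j a
    rcases a with a | a
    · simpa using pow_mem (hyS j) a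
    · rw [zpow_negSucc, ← inv_pow]
      exact pow_mem (hyS' j) _
  have huS : ∀ k, t.coeff k ∈ S := fun k => prod_mem fun a _ => hz a _
  have huS' : ∀ k, (t.coeff k)⁻¹ ∈ S := fun k => by
    rw [Seed.coeff, ← Finset.prod_inv_distrib]
    refine prod_mem fun a _ => ?_
    rw [← zpow_neg]
    exact hz a _
  have hu : ∀ k, t.coeff k ≠ 0 := fun k =>
    Finset.prod_ne_zero_iff.2 fun a _ => zpow_ne_zero _ (hy a)
  have hb : t.negCoeff k ≠ 0 := Finset.prod_ne_zero_iff.2 fun a _ => pow_ne_zero _ (hy a)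
  have hbS : t.negCoeff k ∈ S := prod_mem fun a _ => pow_mem (hyS a) _
  have hbS' : (t.negCoeff k)⁻¹ ∈ S := by
    rw [Seed.negCoeff, ← Finset.prod_inv_distrib]
    refine prod_mem fun a _ => ?_
    rw [← inv_pow]
    exact pow_mem (hyS' a) _
  have hz0 := fun i => ht.var_ne_zero hB i
  have hnum := t.exchange_numerator_ne_zero (ht.algebraicIndependent hB) k
  rw [t.exchange_numerator hs k, ht.posCoeff_eq k, mul_right_comm, mul_comm (t.negCoeff k),
    ← add_mul] at hnum
  have hP := left_ne_zero_of_mul hnum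
  have h1 := ((h k).flip (hz0 _) (hz0 _) (hz0 _) hP (hu _) (hu _) (huS _) (huS' _) (huS _)
    (huS' _)).scale hb hbS hbS'
  have hv : t.negCoeff k * ((t.coeff k * t.var (Sum.inl (k + s)) ^ 2 +
      t.var (Sum.inl (k - s)) ^ 2) / t.var (Sum.inl k)) = (t.mutate k).var (Sum.inl k) := by
    rw [t.mutate_var_self hs k, ht.posCoeff_eq k]
    field_simp
  obtain ⟨c0, c1, c2⟩ := ht.coeff_mutate hs k
  refine containsSeed_of_containsTriple (k := k) (by simpa using hs.1) ?_
  rw [← sub_eq_add_neg, sub_neg_eq_add, c0, c1, c2, ht.posCoeff_eq k, mul_pow, ← mul_assoc,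
    ← hv, t.mutate_var_of_ne k (by simpa using fin_three_add_ne hs.1 k),
    t.mutate_var_of_ne k (by simpa using fin_three_sub_ne hs.1 k)]
  exact h1

theorem IsSeed.containsSeed_iff_mutate {s₀ : Fin 3} (hB : Oriented B s₀) {t : Seed 3 m}
    (ht : IsSeed B t) {s : Fin 3} (hs : Oriented t.mat s) {S : Subalgebra ℂ (RatFun 3 m)}
    (hS : ∀ j, (initialSeed B).var (Sum.inr j) ∈ S)
    (hS' : ∀ j, ((initialSeed B).var (Sum.inr j))⁻¹ ∈ S) (k : Fin 3) :
    ContainsSeed S (t.mutate k) (-s) ↔ ContainsSeed S t s := by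
  refine ⟨fun h => ?_, fun h => ht.containsSeed_mutate hB hs hS hS' h k⟩
  have h1 := (ht.mutate t k).containsSeed_mutate hB (hs.mutate k) hS hS' h k
  rwa [ht.mutate_mutate hB, neg_neg] at h1

/-- The algebra generated by the arcs, the loops and the notched arcs of a seed does not depend on
the seed. -/
theorem IsSeed.exists_containsSeed_iff {s₀ : Fin 3} (hB : Oriented B s₀) {t : Seed 3 m}
    (ht : IsSeed B t) : ∃ s, Oriented t.mat s ∧ ∀ S : Subalgebra ℂ (RatFun 3 m),
      (∀ j, (initialSeed B).var (Sum.inr j) ∈ S) →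
      (∀ j, ((initialSeed B).var (Sum.inr j))⁻¹ ∈ S) →
      (ContainsSeed S t s ↔ ContainsSeed S (initialSeed B) s₀) := by
  induction ht with
  | initial => exact ⟨s₀, hB, fun _ _ _ => Iff.rfl⟩
  | mutate t k ht ih =>
    obtain ⟨s, hs, h⟩ := ih
    exact ⟨-s, hs.mutate k, fun S hS hS' =>
      (ht.containsSeed_iff_mutate hB hs hS hS' k).trans (h S hS hS')⟩

theorem IsSeed.frozen_mem_laurentRing {t : Seed 3 m} (ht : IsSeed B t) (j : Fin m) :
    (initialSeed B).var (Sum.inr j) ∈ laurentRing t := by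
  rw [← ht.var_inr j]
  exact var_mem_laurentRing t _

theorem IsSeed.frozen_inv_mem_laurentRing {t : Seed 3 m} (ht : IsSeed B t) (j : Fin m) :
    ((initialSeed B).var (Sum.inr j))⁻¹ ∈ laurentRing t := by
  rw [← ht.var_inr j]
  exact var_inv_mem_laurentRing t _

theorem containsSeed_laurentRing (t : Seed 3 m) (s : Fin 3) :
    ContainsSeed (laurentRing t) t s := by
  have hv := var_mem_laurentRing t
  have hv' := var_inv_mem_laurentRing t
  have hu : ∀ k, t.coeff k ∈ laurentRing t := fun k => by
    refine prod_mem fun j _ => ?_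
    rcases t.mat (Sum.inr j) k with a | a
    · simpa using pow_mem (hv _) a
    · rw [zpow_negSucc, ← inv_pow]
      exact pow_mem (hv' _) _
  have hl : ∀ i j k a b, loopElt (t.var i) (t.var j) (t.var k) (t.coeff a) (t.coeff b) ∈
      laurentRing t := fun i j k a b => by
    rw [loopElt, div_eq_mul_inv, mul_inv]
    exact mul_mem (add_mem (add_mem (pow_mem (hv _) _) (mul_mem (hu _) (pow_mem (hv _) _)))
      (mul_mem (mul_mem (hu _) (hu _)) (pow_mem (hv _) _))) (mul_mem (hv' _) (hv' _))
  have hn : ∀ i j k a b c, notchedElt (t.var i) (t.var j) (t.var k) (t.coeff a) (t.coeff b)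
      (t.coeff c) ∈ laurentRing t := fun i j k a b c => by
    rw [notchedElt, div_eq_mul_inv]
    exact mul_mem (add_mem (mul_mem (hu _) (pow_mem (hl _ _ _ _ _) _)) (pow_mem (sub_mem
      (one_mem _) (mul_mem (mul_mem (hu _) (hu _)) (hu _))) _)) (hv' _)
  exact fun k => ⟨hv _, hv _, hv _, hl _ _ _ _ _, hl _ _ _ _ _, hl _ _ _ _ _, hn _ _ _ _ _ _,
    hn _ _ _ _ _ _, hn _ _ _ _ _ _⟩

/-- Each Laurent ring contains the arcs, loops and notched arcs of its own seed, hence by invariance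
those of the initial seed. -/
theorem containsSeed_upperClusterAlgebra {s₀ : Fin 3} (hB : Oriented B s₀) :
    ContainsSeed (upperClusterAlgebra B) (initialSeed B) s₀ := by
  have h : ∀ t, IsSeed B t → ContainsSeed (laurentRing t) (initialSeed B) s₀ := fun t ht => by
    obtain ⟨s, -, hs⟩ := ht.exists_containsSeed_iff hB
    exact (hs _ ht.frozen_mem_laurentRing ht.frozen_inv_mem_laurentRing).1
      (containsSeed_laurentRing t s)
  have hmem : ∀ z, (∀ t, IsSeed B t → z ∈ laurentRing t) → z ∈ upperClusterAlgebra B :=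
    fun z hz => by
      simp only [upperClusterAlgebra, Algebra.mem_iInf]
      exact hz
  exact fun k => ⟨hmem _ fun t ht => (h t ht k).arc₁, hmem _ fun t ht => (h t ht k).arc₂,
    hmem _ fun t ht => (h t ht k).arc₃, hmem _ fun t ht => (h t ht k).loop₁,
    hmem _ fun t ht => (h t ht k).loop₂, hmem _ fun t ht => (h t ht k).loop₃,
    hmem _ fun t ht => (h t ht k).notched₁, hmem _ fun t ht => (h t ht k).notched₂,
    hmem _ fun t ht => (h t ht k).notched₃⟩

theorem frozen_mem_upperClusterAlgebra (j : Fin m) :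
    (initialSeed B).var (Sum.inr j) ∈ upperClusterAlgebra B := by
  simp only [upperClusterAlgebra, Algebra.mem_iInf]
  exact fun t ht => ht.frozen_mem_laurentRing j

theorem frozen_inv_mem_upperClusterAlgebra (j : Fin m) :
    ((initialSeed B).var (Sum.inr j))⁻¹ ∈ upperClusterAlgebra B := by
  simp only [upperClusterAlgebra, Algebra.mem_iInf]
  exact fun t ht => ht.frozen_inv_mem_laurentRing j

/-- The Laurent phenomenon. -/
theorem IsSeed.var_mem_upperClusterAlgebra {s₀ : Fin 3} (hB : Oriented B s₀) (t : Seed 3 m)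
    (ht : IsSeed B t) (i) : t.var i ∈ upperClusterAlgebra B := by
  rcases i with i | j
  · obtain ⟨s, -, hs⟩ := ht.exists_containsSeed_iff hB
    exact ((hs _ frozen_mem_upperClusterAlgebra frozen_inv_mem_upperClusterAlgebra).2
      (containsSeed_upperClusterAlgebra hB) i).arc₁
  · rw [ht.var_inr]
    exact frozen_mem_upperClusterAlgebra j

end LaurentPhenomenon

end ClusterAlg

namespace ClusterAlg

/-! ### A plane on which the notched arcs are `1`, and the seeds whose tori cover its curves. -/

section Slice

variable {R : Type*} [CommRing R]

/-- The coefficients along a two-parameter slice of the torus of notched arcs. -/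
def sliceCoeff (s t : R) : Fin 3 → R := ![s, 1, t]

/-- The loops along the slice. -/
def sliceLoop (s t : R) : Fin 3 → R := ![2 + t, 1 + t + s * t, 1 + 2 * s]

/-- The arcs along the slice; the notched arcs are constant with value `1`. -/
def sliceArc (s t : R) : Fin 3 → R := fun k =>
  sliceCoeff s t k * sliceLoop s t k ^ 2 + (1 - s * t) ^ 2

/-- The flips of the arcs along the slice. -/
def sliceFlip (s t : R) : Fin 3 → R := fun k =>
  sliceLoop s t (k + 1) * sliceArc s t (k - 1) -
    sliceCoeff s t (k - 1) * sliceCoeff s t k * sliceArc s t k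

/-- The exchange relation, which identifies `sliceFlip` as the value of the mutated variable; the
polynomial form is modelled on `flip_eq`. -/
theorem sliceArc_mul_sliceFlip (s t : R) (k : Fin 3) :
    sliceArc s t k * sliceFlip s t k =
      sliceCoeff s t k * sliceArc s t (k + 1) ^ 2 + sliceArc s t (k - 1) ^ 2 := by
  fin_cases k <;> simp [sliceArc, sliceFlip, sliceLoop, sliceCoeff] <;> ring

theorem sliceLoop_mul (s t : R) (k : Fin 3) :
    sliceLoop s t k * (sliceArc s t (k + 1) * sliceArc s t (k - 1)) =
      sliceArc s t (k + 1) ^ 2 + sliceCoeff s t (k - 1) * sliceArc s t k ^ 2 +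
        sliceCoeff s t (k + 1) * sliceCoeff s t (k - 1) * sliceArc s t (k - 1) ^ 2 := by
  fin_cases k <;> simp [sliceArc, sliceLoop, sliceCoeff] <;> ring

/-- Every prime of the slice that is not excluded avoids one of the denominators of four seeds. -/
theorem exists_not_dvd_slice [IsDomain R] {s t π : R} (hπ : Prime π) (hs : ¬π ∣ s)
    (hs1 : ¬π ∣ s + 1) (ht1 : ¬π ∣ t + 1) (h4 : ¬π ∣ 4 * s ^ 2 + 1) (h2 : ¬π ∣ 2)
    (hL : ¬(π ∣ 2 + t ∧ π ∣ 1 + 2 * s)) :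
    (∀ j, ¬π ∣ sliceArc s t j) ∨
      ∃ k, ¬π ∣ sliceFlip s t k ∧ ∀ j, j ≠ k → ¬π ∣ sliceArc s t j := by
  have hε : ∀ c, ¬π ∣ c → π ∣ c * (1 - s * t) ^ 2 → π ∣ 1 - s * t := fun c hc h =>
    hπ.dvd_of_dvd_pow ((hπ.dvd_or_dvd h).resolve_left hc)
  -- With `ε = 1 - st` the loops are `ℓ₀ = 2 + t`, `ℓ₁ = ℓ₀ - ε`, `ℓ₂ = ε + sℓ₀`. A prime dividing
  -- `ε` and `ℓ₀` divides `ℓ₂` too, against `hL`; all cases below are reduced to this contradiction.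
  have hεL : π ∣ 1 - s * t → ¬π ∣ 2 + t := fun h h' =>
    hL ⟨h', by
      rw [show 1 + 2 * s = (1 - s * t) + s * (2 + t) by ring]
      exact dvd_add h (h'.mul_left _)⟩
  have e0 : sliceArc s t 0 = s * (2 + t) ^ 2 + (1 - s * t) ^ 2 := rfl
  have e1 : sliceArc s t 1 = 1 * (1 + t + s * t) ^ 2 + (1 - s * t) ^ 2 := rfl
  have e2 : sliceArc s t 2 = t * (1 + 2 * s) ^ 2 + (1 - s * t) ^ 2 := rfl
  have h01 : ¬(π ∣ sliceArc s t 0 ∧ π ∣ sliceArc s t 1) := by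
    rintro ⟨h0, h1⟩
    have hε' : π ∣ 1 - s * t := by
      have h : π ∣ (1 - s * t) * (-2 * s * (2 + t) + (2 * s - 1) * (1 - s * t)) := by
        rw [show (1 - s * t) * (-2 * s * (2 + t) + (2 * s - 1) * (1 - s * t)) =
          s * sliceArc s t 1 - sliceArc s t 0 by rw [e0, e1]; ring]
        exact dvd_sub (h1.mul_left _) h0
      rcases hπ.dvd_or_dvd h with h | h
      · exact h
      -- If the other factor is divisible, a difference of squares eliminates `ℓ₀` and leaves `(4s²
      -- + 1)ε²`.
      · refine hε _ h4 ?_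
        rw [show (4 * s ^ 2 + 1) * (1 - s * t) ^ 2 = 4 * s * sliceArc s t 0 -
          (-2 * s * (2 + t) + (2 * s - 1) * (1 - s * t)) *
            (-2 * s * (2 + t) - (2 * s - 1) * (1 - s * t)) by rw [e0]; ring]
        exact dvd_sub (h0.mul_left _) (h.mul_right _)
    have h3 : π ∣ s * (2 + t) ^ 2 := by
      rw [show s * (2 + t) ^ 2 = sliceArc s t 0 - (1 - s * t) * (1 - s * t) by rw [e0]; ring]
      exact dvd_sub h0 (hε'.mul_left _)
    exact hεL hε' (hπ.dvd_of_dvd_pow ((hπ.dvd_or_dvd h3).resolve_left hs))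
  have h02 : ¬(π ∣ sliceArc s t 0 ∧ π ∣ sliceArc s t 2) := by
    rintro ⟨h0, h2⟩
    refine h01 ⟨h0, ?_⟩
    -- By the exchange relation, two vanishing arcs force the third to vanish.
    have h : π ∣ s * sliceArc s t 1 ^ 2 := by
      rw [show s * sliceArc s t 1 ^ 2 = sliceArc s t 0 * sliceFlip s t 0 -
        sliceArc s t 2 * sliceArc s t 2 by
          rw [sliceArc_mul_sliceFlip]
          change _ = s * sliceArc s t 1 ^ 2 + sliceArc s t 2 ^ 2 - _
          ring]
      exact dvd_sub (h0.mul_right _) (h2.mul_right _)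
    exact hπ.dvd_of_dvd_pow ((hπ.dvd_or_dvd h).resolve_left hs)
  have h12 : ¬(π ∣ sliceArc s t 1 ∧ π ∣ sliceArc s t 2) := by
    rintro ⟨h1, h2⟩
    refine h01 ⟨?_, h1⟩
    have h : π ∣ sliceArc s t 0 ^ 2 := by
      rw [show sliceArc s t 0 ^ 2 = sliceArc s t 1 * sliceFlip s t 1 -
        sliceArc s t 2 * sliceArc s t 2 by
          rw [sliceArc_mul_sliceFlip]
          change _ = 1 * sliceArc s t 2 ^ 2 + sliceArc s t 0 ^ 2 - _
          ring]
      exact dvd_sub (h1.mul_right _) (h2.mul_right _)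
    exact hπ.dvd_of_dvd_pow h
  -- Modulo `π` the flip is a loop times another arc, and that arc is nonzero, so the loop vanishes.
  -- Here `ℓ₁ = 0` gives `ℓ₀ = ε`, and the arc becomes `(s + 1)ε²`. In the next two cases `ℓ₂ = 0`
  -- gives `ℓ₁ = ε` and `2ε²`, and `ℓ₀ = 0` gives `ℓ₂ = ε` and `(t + 1)ε²`.
  have f0 : π ∣ sliceArc s t 0 → ¬π ∣ sliceFlip s t 0 := by
    intro h hf
    have hl : π ∣ (1 + t + s * t) * sliceArc s t 2 := by
      rw [show (1 + t + s * t) * sliceArc s t 2 = sliceFlip s t 0 + t * s * sliceArc s t 0 by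
        change _ = (1 + t + s * t) * sliceArc s t 2 - t * s * sliceArc s t 0 + _
        ring]
      exact dvd_add hf (h.mul_left _)
    have hl := (hπ.dvd_or_dvd hl).resolve_right fun h' => h02 ⟨h, h'⟩
    have he := hε _ hs1 (by
      rw [show (s + 1) * (1 - s * t) ^ 2 = sliceArc s t 0 -
        (1 + t + s * t) * (s * (2 + t + (1 - s * t))) by rw [e0]; ring]
      exact dvd_sub h (hl.mul_right _))
    refine hεL he ?_
    rw [show 2 + t = (1 + t + s * t) + (1 - s * t) by ring]
    exact dvd_add hl he
  have f1 : π ∣ sliceArc s t 1 → ¬π ∣ sliceFlip s t 1 := by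
    intro h hf
    have hl : π ∣ (1 + 2 * s) * sliceArc s t 0 := by
      rw [show (1 + 2 * s) * sliceArc s t 0 = sliceFlip s t 1 + s * 1 * sliceArc s t 1 by
        change _ = (1 + 2 * s) * sliceArc s t 0 - s * 1 * sliceArc s t 1 + _
        ring]
      exact dvd_add hf (h.mul_left _)
    have hl := (hπ.dvd_or_dvd hl).resolve_right fun h' => h01 ⟨h', h⟩
    have he := hε _ h2 (by
      rw [show 2 * (1 - s * t) ^ 2 = sliceArc s t 1 -
        (1 + 2 * s) * (t * (1 + t + s * t + (1 - s * t))) by rw [e1]; ring]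
      exact dvd_sub h (hl.mul_right _))
    refine hεL he ?_
    rw [show 2 + t = 2 * (1 - s * t) + t * (1 + 2 * s) by ring]
    exact dvd_add (he.mul_left _) (hl.mul_left _)
  have f2 : π ∣ sliceArc s t 2 → ¬π ∣ sliceFlip s t 2 := by
    intro h hf
    have hl : π ∣ (2 + t) * sliceArc s t 1 := by
      rw [show (2 + t) * sliceArc s t 1 = sliceFlip s t 2 + 1 * t * sliceArc s t 2 by
        change _ = (2 + t) * sliceArc s t 1 - 1 * t * sliceArc s t 2 + _
        ring]
      exact dvd_add hf (h.mul_left _)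
    have hl := (hπ.dvd_or_dvd hl).resolve_right fun h' => h12 ⟨h', h⟩
    have he := hε _ ht1 (by
      rw [show (t + 1) * (1 - s * t) ^ 2 = sliceArc s t 2 -
        (2 + t) * (t * (s * (1 + 2 * s + (1 - s * t)))) by rw [e2]; ring]
      exact dvd_sub h (hl.mul_right _))
    exact hεL he hl
  have key : ∀ k, π ∣ sliceArc s t k → ¬π ∣ sliceFlip s t k ∧ ∀ j, j ≠ k → ¬π ∣ sliceArc s t j := by
    intro k h
    fin_cases k
    · refine ⟨f0 h, fun j hj h' => ?_⟩
      fin_cases j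
      exacts [hj rfl, h01 ⟨h, h'⟩, h02 ⟨h, h'⟩]
    · refine ⟨f1 h, fun j hj h' => ?_⟩
      fin_cases j
      exacts [h01 ⟨h', h⟩, hj rfl, h12 ⟨h, h'⟩]
    · refine ⟨f2 h, fun j hj h' => ?_⟩
      fin_cases j
      exacts [h02 ⟨h', h⟩, h12 ⟨h', h⟩, hj rfl]
  by_cases h : ∀ j, ¬π ∣ sliceArc s t j
  · exact Or.inl h
  · push Not at h
    obtain ⟨k, hk⟩ := h
    exact Or.inr ⟨k, key k hk⟩

end Slice

/-! ### Regularity of fractions over a factorial domain, tested prime by prime. -/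

section RegularFractions

variable {P K : Type*} [CommRing P] [IsDomain P] [UniqueFactorizationMonoid P] [Field K]
  [Algebra P K] [IsFractionRing P K]

/-- The reduced denominator is optimal at all primes at once: if `π ∣ b` but `π ∤ b'`, then `a * b'
= a' * b` makes `π` divide `a`, against coprimality. -/
theorem exists_reduced_fraction_not_dvd (f : K) :
    ∃ a b : P, b ≠ 0 ∧ f * algebraMap P K b = algebraMap P K a ∧ ∀ π : P, Prime π →
      (∃ a' b' : P, ¬π ∣ b' ∧ f * algebraMap P K b' = algebraMap P K a') → ¬π ∣ b := by
  obtain ⟨a, b, hab, hf⟩ := IsFractionRing.exists_reduced_fraction (A := P) f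
  have hinj := IsFractionRing.injective P K
  have hfb : f * algebraMap P K b = algebraMap P K a := by
    rw [← hf]
    exact IsLocalization.mk'_spec K a b
  refine ⟨a, b, nonZeroDivisors.coe_ne_zero b, hfb, fun π hπ h hπb => ?_⟩
  obtain ⟨a', b', hb', hf'⟩ := h
  have heq : a * b' = a' * b := by
    apply hinj
    rw [map_mul, map_mul, ← hfb, ← hf']
    ring
  have hπa : π ∣ a :=
    (hπ.dvd_or_dvd (heq ▸ hπb.mul_left a' : π ∣ a * b')).resolve_right hb'
  exact hπ.not_isUnit (hab hπa hπb)

/-- A fraction over a factorial domain whose denominator can be chosen away from each prime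
vanishing at a point has a denominator that does not vanish at the point. -/
theorem exists_mul_eq_of_forall_prime {k : Type*} [Field k] (ev : P →+* k) (f : K)
    (h : ∀ π : P, Prime π → ev π = 0 →
      ∃ a b : P, ¬π ∣ b ∧ f * algebraMap P K b = algebraMap P K a) :
    ∃ a b : P, ev b ≠ 0 ∧ f * algebraMap P K b = algebraMap P K a := by
  obtain ⟨a, b, hb0, hfb, hb⟩ := exists_reduced_fraction_not_dvd (P := P) f
  refine ⟨a, b, fun hev => ?_, hfb⟩
  have hprime : ∀ c : P, c ≠ 0 → ev c = 0 → ∃ π, Prime π ∧ π ∣ c ∧ ev π = 0 := by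
    intro c
    induction c using UniqueFactorizationMonoid.induction_on_prime with
    | h₁ => exact fun h => absurd rfl h
    | h₂ x hx => exact fun _ h => absurd h (hx.map ev).ne_zero
    | h₃ a p ha hp ih =>
      intro _ h
      rw [map_mul, mul_eq_zero] at h
      rcases h with h | h
      · exact ⟨p, hp, dvd_mul_right _ _, h⟩
      · obtain ⟨π, h1, h2, h3⟩ := ih ha h
        exact ⟨π, h1, h2.mul_left _, h3⟩
  obtain ⟨π, hπ, hπb, hπ0⟩ := hprime b hb0 hev
  exact hb π hπ (h π hπ hπ0) hπb

/-- A fraction over a factorial domain whose denominator can be chosen away from each prime is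
integral. -/
theorem exists_algebraMap_eq_of_forall_prime (f : K)
    (h : ∀ π : P, Prime π → ∃ a b : P, ¬π ∣ b ∧ f * algebraMap P K b = algebraMap P K a) :
    ∃ a : P, f = algebraMap P K a := by
  obtain ⟨a, b, hb0, hfb, hb⟩ := exists_reduced_fraction_not_dvd (P := P) f
  have hu : IsUnit b := by
    by_contra hu
    obtain ⟨π, hπ, hπb⟩ := WfDvdMonoid.exists_irreducible_factor hu hb0
    exact hb π hπ.prime (h π hπ.prime) hπb
  obtain ⟨c, hc⟩ := hu.exists_right_inv
  refine ⟨a * c, ?_⟩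
  rw [map_mul, ← hfb, mul_assoc, ← map_mul, hc, map_one, mul_one]

end RegularFractions

/-! ### The base point `(s, t) = (-1/2, -2)` of the slice. -/

section SlicePoint

open Polynomial

/-- The coordinate ring of the parameter plane of the slice. -/
abbrev SliceRing : Type := Polynomial (Polynomial ℂ)

/-- Evaluation at the base point of the slice. -/
noncomputable def sliceEval : SliceRing →ₐ[ℂ] ℂ :=
  { Polynomial.eval₂RingHom (Polynomial.evalRingHom (-1 / 2 : ℂ)) (-2) with
    commutes' := fun a => by
      change Polynomial.eval₂ _ _ (algebraMap ℂ SliceRing a) = a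
      rw [Polynomial.algebraMap_apply, Polynomial.eval₂_C]
      simp }

/-- The first parameter. -/
noncomputable def paramS : SliceRing := C X

/-- The second parameter. -/
noncomputable def paramT : SliceRing := X

theorem sliceEval_paramS : sliceEval paramS = -1 / 2 := by
  change Polynomial.eval₂ _ _ (C X) = _
  simp

theorem sliceEval_paramT : sliceEval paramT = -2 := by
  change Polynomial.eval₂ _ _ X = _
  simp

/-- At the base point `st = 1` and all three loops vanish. -/
theorem sliceEval_sliceArc (k : Fin 3) : sliceEval (sliceArc paramS paramT k) = 0 := by
  have h2 : sliceEval 2 = 2 := map_ofNat sliceEval 2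
  fin_cases k <;>
    simp [sliceArc, sliceCoeff, sliceLoop, h2, sliceEval_paramS, sliceEval_paramT] <;> norm_num

theorem not_dvd_of_sliceEval_ne_zero {π a : SliceRing} (hπ : sliceEval π = 0)
    (ha : sliceEval a ≠ 0) : ¬π ∣ a := by
  rintro ⟨b, rfl⟩
  exact ha (by rw [map_mul, hπ, zero_mul])

theorem exists_not_dvd_sliceArc {π : SliceRing} (hπ : Prime π) (h0 : sliceEval π = 0) :
    (∀ j, ¬π ∣ sliceArc paramS paramT j) ∨
      ∃ k, ¬π ∣ sliceFlip paramS paramT k ∧ ∀ j, j ≠ k → ¬π ∣ sliceArc paramS paramT j := by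
  have hn : ∀ a, sliceEval a ≠ 0 → ¬π ∣ a := fun a => not_dvd_of_sliceEval_ne_zero h0
  refine exists_not_dvd_slice hπ (hn _ ?_) (hn _ ?_) (hn _ ?_) (hn _ ?_) (hn _ ?_) ?_
  · rw [sliceEval_paramS]; norm_num
  · rw [map_add, map_one, sliceEval_paramS]; norm_num
  · rw [map_add, map_one, sliceEval_paramT]; norm_num
  · rw [map_add, map_one, map_mul, map_pow, sliceEval_paramS, map_ofNat]; norm_num
  · rw [map_ofNat]; norm_num
  -- The lines `t = -2` and `s = -1/2` have no common component: `π` would be associated to `t + 2`,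
  -- which does not divide a nonzero polynomial in `s` alone.
  · rintro ⟨h1, h2⟩
    have e1 : (2 + paramT : SliceRing) = X - C (-2) := by
      rw [paramT, map_neg, sub_neg_eq_add, add_comm, map_ofNat C 2]
    have e2 : (1 + 2 * paramS : SliceRing) = C (1 + 2 * X) := by
      rw [paramS, map_add, map_mul, map_one, map_ofNat C 2]
    rw [e1] at h1
    rw [e2] at h2
    have h3 : (X - C (-2) : SliceRing) ∣ C (1 + 2 * X) :=
      (hπ.associated_of_dvd (prime_X_sub_C _) h1).symm.dvd.trans h2
    rw [dvd_iff_isRoot, IsRoot.def, eval_C] at h3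
    have h4 := congrArg (Polynomial.eval 0) h3
    simp at h4

theorem sliceArc_ne_zero (k : Fin 3) : sliceArc paramS paramT k ≠ 0 := by
  intro h
  -- At `s = 1`, `t = 2` no arc vanishes.
  have h1 := congrArg (Polynomial.eval₂RingHom (Polynomial.evalRingHom (1 : ℂ)) 2) h
  fin_cases k <;>
    simp [sliceArc, sliceCoeff, sliceLoop, paramS, paramT] at h1 <;> norm_num at h1

theorem sliceCoeff_ne_zero (k : Fin 3) : sliceCoeff paramS paramT k ≠ 0 := by
  fin_cases k <;> simp [sliceCoeff, paramS, paramT]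

end SlicePoint

end ClusterAlg

namespace ClusterAlg

/-! ### The mysterious point of the upper cluster algebra with principal coefficients. -/

section MysteriousPoint

local notation "𝔹" => markovPrinMatrix

local notation "𝕂" => FractionRing SliceRing

/-- The values of the initial extended cluster along the slice. -/
noncomputable def sliceVar : Fin 3 ⊕ Fin 3 → SliceRing :=
  Sum.elim (sliceArc paramS paramT) (sliceCoeff paramS paramT)

theorem upperClusterAlgebra_le_laurentRing {n m : ℕ} {B : Matrix (Fin n ⊕ Fin m) (Fin n) ℤ}
    {t : Seed n m} (ht : IsSeed B t) : upperClusterAlgebra B ≤ laurentRing t := by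
  intro z hz
  simp only [upperClusterAlgebra, Algebra.mem_iInf] at hz
  exact hz t ht

theorem var_mem_upper {t : Seed 3 3} (ht : IsSeed 𝔹 t) (i) : t.var i ∈ upperClusterAlgebra 𝔹 :=
  IsSeed.var_mem_upperClusterAlgebra oriented_markovPrinMatrix t ht i

/-- Restriction of the elements of the upper cluster algebra to the slice. -/
theorem exists_slice_algHom : ∃ Ψ : upperClusterAlgebra 𝔹 →ₐ[ℂ] 𝕂,
    ∀ i, Ψ ⟨(initialSeed 𝔹).var i, var_mem_upper IsSeed.initial i⟩ =
      algebraMap SliceRing 𝕂 (sliceVar i) := by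
  obtain ⟨q, hq⟩ := exists_laurentRing_algHom
    (IsSeed.initial.algebraicIndependent oriented_markovPrinMatrix)
    (fun i => algebraMap SliceRing 𝕂 (sliceVar i)) (fun i => by
      rw [Ne, FaithfulSMul.algebraMap_eq_zero_iff]
      rcases i with k | k
      · exact sliceArc_ne_zero k
      · exact sliceCoeff_ne_zero k)
  exact ⟨q.comp (Subalgebra.inclusion (upperClusterAlgebra_le_laurentRing IsSeed.initial)),
    fun i => hq i⟩

theorem initialSeed_posCoeff (k : Fin 3) :
    (initialSeed 𝔹).posCoeff k = (initialSeed 𝔹).var (Sum.inr k) := by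
  simp only [Seed.posCoeff]
  rw [Finset.prod_eq_single k]
  · simp [initialSeed, markovPrinMatrix]
  · intro j _ hj
    simp [initialSeed, markovPrinMatrix, Matrix.one_apply_ne hj]
  · simp

theorem initialSeed_negCoeff (k : Fin 3) : (initialSeed 𝔹).negCoeff k = 1 := by
  simp only [Seed.negCoeff]
  refine Finset.prod_eq_one fun j _ => ?_
  by_cases hj : j = k
  · subst hj
    simp [initialSeed, markovPrinMatrix]
  · simp [initialSeed, markovPrinMatrix, Matrix.one_apply_ne hj]

theorem initialSeed_coeff (k : Fin 3) :
    (initialSeed 𝔹).coeff k = (initialSeed 𝔹).var (Sum.inr k) := by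
  rw [← initialSeed_posCoeff, IsSeed.initial.posCoeff_eq, initialSeed_negCoeff, mul_one]

theorem initialSeed_exchange (k : Fin 3) :
    (initialSeed 𝔹).var (Sum.inl k) * ((initialSeed 𝔹).mutate k).var (Sum.inl k) =
      (initialSeed 𝔹).var (Sum.inr k) * (initialSeed 𝔹).var (Sum.inl (k + 1)) ^ 2 +
        (initialSeed 𝔹).var (Sum.inl (k - 1)) ^ 2 := by
  rw [IsSeed.initial.exchange oriented_markovPrinMatrix oriented_markovPrinMatrix k,
    initialSeed_posCoeff, initialSeed_negCoeff, one_mul]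

variable {Ψ : upperClusterAlgebra 𝔹 →ₐ[ℂ] 𝕂}

theorem slice_algHom_flip
    (hΨ : ∀ i, Ψ ⟨(initialSeed 𝔹).var i, var_mem_upper IsSeed.initial i⟩ =
      algebraMap SliceRing 𝕂 (sliceVar i)) (k : Fin 3) :
    Ψ ⟨((initialSeed 𝔹).mutate k).var (Sum.inl k),
      var_mem_upper (IsSeed.initial.mutate _ k) _⟩ =
      algebraMap SliceRing 𝕂 (sliceFlip paramS paramT k) := by
  have h0 : algebraMap SliceRing 𝕂 (sliceArc paramS paramT k) ≠ 0 := by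
    rw [Ne, FaithfulSMul.algebraMap_eq_zero_iff]
    exact sliceArc_ne_zero k
  refine mul_left_cancel₀ h0 ?_
  rw [← map_mul, sliceArc_mul_sliceFlip]
  have h : (⟨_, var_mem_upper IsSeed.initial (Sum.inl k)⟩ : upperClusterAlgebra 𝔹) *
      ⟨_, var_mem_upper (IsSeed.initial.mutate _ k) (Sum.inl k)⟩ =
      ⟨_, var_mem_upper IsSeed.initial (Sum.inr k)⟩ *
        ⟨_, var_mem_upper IsSeed.initial (Sum.inl (k + 1))⟩ ^ 2 +
        ⟨_, var_mem_upper IsSeed.initial (Sum.inl (k - 1))⟩ ^ 2 :=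
    Subtype.ext (initialSeed_exchange k)
  have h' := congrArg Ψ h
  simp only [map_mul, map_add, map_pow, hΨ] at h'
  rw [map_add, map_mul, map_pow, map_pow]
  exact h'

/-- Hartogs: only primes through the base point matter, and for each of them one of four seeds has
all its variables prime to it. The Laurent expansion in that seed provides the denominator. -/
theorem slice_algHom_regular
    (hΨ : ∀ i, Ψ ⟨(initialSeed 𝔹).var i, var_mem_upper IsSeed.initial i⟩ =
      algebraMap SliceRing 𝕂 (sliceVar i)) (u : upperClusterAlgebra 𝔹) :
    ∃ a b : SliceRing, sliceEval b ≠ 0 ∧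
      Ψ u * algebraMap SliceRing 𝕂 b = algebraMap SliceRing 𝕂 a := by
  refine exists_mul_eq_of_forall_prime (sliceEval : SliceRing →+* ℂ) (Ψ u) fun π hπ hπ0 => ?_
  have hcoeff : ∀ j, ¬π ∣ sliceCoeff paramS paramT j := fun j => by
    refine not_dvd_of_sliceEval_ne_zero hπ0 ?_
    fin_cases j <;> simp [sliceCoeff, sliceEval_paramS, sliceEval_paramT]
  suffices h : ∃ (t : Seed 3 3) (ht : IsSeed 𝔹 t) (v : Fin 3 ⊕ Fin 3 → SliceRing),
      (∀ i, Ψ ⟨t.var i, var_mem_upper ht i⟩ = algebraMap SliceRing 𝕂 (v i)) ∧ ∀ i, ¬π ∣ v i by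
    obtain ⟨t, ht, v, hv, hπv⟩ := h
    obtain ⟨N, g, hg⟩ := map_mul_prod_pow_eq
      (fun i => ht.var_ne_zero oriented_markovPrinMatrix i)
      (upperClusterAlgebra_le_laurentRing ht u.2)
    have h1 := hg _ (var_mem_upper ht) u.2 𝕂 Ψ
    simp only [hv] at h1
    refine ⟨MvPolynomial.aeval v g, (∏ i, v i) ^ N, fun h => ?_, ?_⟩
    · obtain ⟨i, -, hi⟩ := (Prime.dvd_finsetProd_iff hπ _).1 (hπ.dvd_of_dvd_pow h)
      exact hπv i hi
    · rw [map_pow, map_prod]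
      refine h1.trans ?_
      exact (MvPolynomial.comp_aeval_apply v (IsScalarTower.toAlgHom ℂ SliceRing 𝕂) g).symm
  rcases exists_not_dvd_sliceArc hπ hπ0 with h | ⟨k, hk, h⟩
  · refine ⟨_, IsSeed.initial, sliceVar, hΨ, ?_⟩
    rintro (j | j)
    exacts [h j, hcoeff j]
  · refine ⟨_, IsSeed.initial.mutate _ k,
      Function.update sliceVar (Sum.inl k) (sliceFlip paramS paramT k), fun i => ?_, fun i => ?_⟩
    · by_cases hi : i = Sum.inl k
      · subst hi
        rw [Function.update_self]
        exact slice_algHom_flip hΨ k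
      · rw [Function.update_of_ne hi, ← hΨ]
        congr 2
        exact Seed.mutate_var_of_ne _ k hi
    · by_cases hi : i = Sum.inl k
      · subst hi
        rwa [Function.update_self]
      · rw [Function.update_of_ne hi]
        rcases i with j | j
        · exact h j fun h' => hi (by rw [h'])
        · exact hcoeff j

/-- The point is `Ψ` followed by evaluation at the base point; the value does not depend on the
fraction chosen (`key`), which gives all the homomorphism laws. -/
theorem exists_point_of_slice (Ψ : upperClusterAlgebra 𝔹 →ₐ[ℂ] 𝕂)
    (h : ∀ u, ∃ a b : SliceRing, sliceEval b ≠ 0 ∧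
      Ψ u * algebraMap SliceRing 𝕂 b = algebraMap SliceRing 𝕂 a) :
    ∃ p : Points (upperClusterAlgebra 𝔹), ∀ u (a : SliceRing),
      Ψ u = algebraMap SliceRing 𝕂 a → p u = sliceEval a := by
  choose a b hb hab using h
  have hinj := IsFractionRing.injective SliceRing 𝕂
  have key : ∀ u (c d : SliceRing), sliceEval d ≠ 0 →
      Ψ u * algebraMap SliceRing 𝕂 d = algebraMap SliceRing 𝕂 c →
      sliceEval (a u) / sliceEval (b u) = sliceEval c / sliceEval d := by
    intro u c d hd hcd
    rw [div_eq_div_iff (hb u) hd, ← map_mul, ← map_mul]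
    congr 1
    apply hinj
    rw [map_mul, map_mul, ← hcd, ← hab]
    ring
  refine ⟨⟨⟨⟨⟨fun u => sliceEval (a u) / sliceEval (b u), ?_⟩, ?_⟩, ?_, ?_⟩, ?_⟩, ?_⟩
  · rw [key 1 1 1 (by simp) (by simp)]
    simp
  · intro u v
    change sliceEval (a (u * v)) / sliceEval (b (u * v)) =
      sliceEval (a u) / sliceEval (b u) * (sliceEval (a v) / sliceEval (b v))
    rw [key (u * v) (a u * a v) (b u * b v) (by simp [hb]) (by
      rw [map_mul, map_mul, map_mul, ← hab, ← hab]; ring)]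
    simp only [map_mul]
    rw [mul_div_mul_comm]
  · change sliceEval (a 0) / sliceEval (b 0) = 0
    rw [key 0 0 1 (by simp) (by simp)]
    simp
  · intro u v
    change sliceEval (a (u + v)) / sliceEval (b (u + v)) =
      sliceEval (a u) / sliceEval (b u) + sliceEval (a v) / sliceEval (b v)
    rw [key (u + v) (a u * b v + a v * b u) (b u * b v) (by simp [hb]) (by
      rw [map_mul, map_add, map_add, map_mul, map_mul, ← hab, ← hab]; ring)]
    simp only [map_mul, map_add]
    have h1 := hb u
    have h2 := hb v
    field_simp
  · intro r
    change sliceEval (a (algebraMap ℂ _ r)) / sliceEval (b (algebraMap ℂ _ r)) = algebraMap ℂ ℂ r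
    rw [key (algebraMap ℂ _ r) (algebraMap ℂ SliceRing r) 1 (by simp) (by
      rw [AlgHom.commutes, map_one, mul_one]
      exact IsScalarTower.algebraMap_apply ℂ SliceRing 𝕂 r), AlgHom.commutes]
    simp
  · intro u c hc
    change sliceEval (a u) / sliceEval (b u) = _
    rw [key u c 1 (by simp) (by rw [hc]; simp)]
    simp

theorem loopElt_mem_upper (k : Fin 3) :
    loopElt ((initialSeed 𝔹).var (Sum.inl k)) ((initialSeed 𝔹).var (Sum.inl (k + 1)))
      ((initialSeed 𝔹).var (Sum.inl (k - 1))) ((initialSeed 𝔹).var (Sum.inr (k + 1)))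
      ((initialSeed 𝔹).var (Sum.inr (k - 1))) ∈ upperClusterAlgebra 𝔹 := by
  have h := (containsSeed_upperClusterAlgebra oriented_markovPrinMatrix k).loop₁
  rwa [initialSeed_coeff, initialSeed_coeff] at h

/-- The notched arcs of the initial seed. -/
noncomputable def notchedArc (k : Fin 3) : RatFun 3 3 :=
  notchedElt ((initialSeed 𝔹).var (Sum.inl k)) ((initialSeed 𝔹).var (Sum.inl (k + 1)))
    ((initialSeed 𝔹).var (Sum.inl (k - 1))) ((initialSeed 𝔹).var (Sum.inr k))
    ((initialSeed 𝔹).var (Sum.inr (k + 1))) ((initialSeed 𝔹).var (Sum.inr (k - 1)))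

theorem notchedArc_mem_upper (k : Fin 3) : notchedArc k ∈ upperClusterAlgebra 𝔹 := by
  have h := (containsSeed_upperClusterAlgebra oriented_markovPrinMatrix k).notched₁
  rwa [initialSeed_coeff, initialSeed_coeff, initialSeed_coeff] at h

/-- Arc times notched arc is `u_k ℓ_k² + (1 - u₁u₂u₃)²`, and `sliceArc` is defined as the value of
exactly this expression, with product of coefficients `st`. -/
theorem slice_algHom_notchedArc
    (hΨ : ∀ i, Ψ ⟨(initialSeed 𝔹).var i, var_mem_upper IsSeed.initial i⟩ =
      algebraMap SliceRing 𝕂 (sliceVar i)) (k : Fin 3) :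
    Ψ ⟨notchedArc k, notchedArc_mem_upper k⟩ = 1 := by
  have hx : ∀ i, (initialSeed 𝔹).var i ≠ 0 :=
    fun i => IsSeed.initial.var_ne_zero oriented_markovPrinMatrix i
  have h0 : ∀ k, algebraMap SliceRing 𝕂 (sliceArc paramS paramT k) ≠ 0 := fun k => by
    rw [Ne, FaithfulSMul.algebraMap_eq_zero_iff]
    exact sliceArc_ne_zero k
  let x : Fin 3 → upperClusterAlgebra 𝔹 := fun k => ⟨_, var_mem_upper IsSeed.initial (Sum.inl k)⟩
  let y : Fin 3 → upperClusterAlgebra 𝔹 := fun k => ⟨_, var_mem_upper IsSeed.initial (Sum.inr k)⟩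
  have hΨx : ∀ k, Ψ (x k) = algebraMap SliceRing 𝕂 (sliceArc paramS paramT k) :=
    fun k => hΨ (Sum.inl k)
  have hΨy : ∀ k, Ψ (y k) = algebraMap SliceRing 𝕂 (sliceCoeff paramS paramT k) :=
    fun k => hΨ (Sum.inr k)
  let l : upperClusterAlgebra 𝔹 := ⟨_, loopElt_mem_upper k⟩
  have hl : l * (x (k + 1) * x (k - 1)) = x (k + 1) ^ 2 + y (k - 1) * x k ^ 2 +
      y (k + 1) * y (k - 1) * x (k - 1) ^ 2 := by
    apply Subtype.ext
    change loopElt _ _ _ _ _ * (_ * _) = _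
    rw [loopElt, div_mul_cancel₀ _ (mul_ne_zero (hx _) (hx _))]
    rfl
  have hΨl : Ψ l = algebraMap SliceRing 𝕂 (sliceLoop paramS paramT k) := by
    refine mul_right_cancel₀ (mul_ne_zero (h0 (k + 1)) (h0 (k - 1))) ?_
    have h := congrArg Ψ hl
    simp only [map_mul, map_add, map_pow, hΨx, hΨy] at h
    rw [h]
    simp only [← map_mul, ← map_add, ← map_pow]
    rw [sliceLoop_mul]
  have hn : x k * ⟨notchedArc k, notchedArc_mem_upper k⟩ =
      y k * l ^ 2 + (1 - y k * y (k + 1) * y (k - 1)) ^ 2 := by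
    apply Subtype.ext
    change _ * notchedArc k = _
    rw [notchedArc, notchedElt, mul_div_cancel₀ _ (hx _)]
    rfl
  have h := congrArg Ψ hn
  have hprod : sliceCoeff paramS paramT k * sliceCoeff paramS paramT (k + 1) *
      sliceCoeff paramS paramT (k - 1) = paramS * paramT := by
    rw [← prod_fin_three_cyclic _ k (by decide), Fin.prod_univ_three]
    simp [sliceCoeff]
  simp only [map_mul, map_add, map_pow, map_sub, map_one, hΨx, hΨy, hΨl] at h
  refine mul_left_cancel₀ (h0 k) (h.trans ?_)
  rw [← map_mul, ← map_mul, hprod, mul_one, sliceArc]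
  simp only [map_mul, map_add, map_pow, map_sub, map_one]

/-- The conditions say that the exchange relations are homogeneous. They imply `b₁b₂b₃ = 1` and make
the numerator of the notched arc invariant, so only the division by the arc contributes. -/
theorem notchedElt_scale {F : Type*} [Field F] {x₁ x₂ x₃ u₁ u₂ u₃ a₁ a₂ a₃ b₁ b₂ b₃ : F}
    (h1 : a₁ ≠ 0) (h2 : a₂ ≠ 0) (h3 : a₃ ≠ 0) (e1 : b₁ * a₂ ^ 2 = a₃ ^ 2)
    (e2 : b₂ * a₃ ^ 2 = a₁ ^ 2) (e3 : b₃ * a₁ ^ 2 = a₂ ^ 2) :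
    notchedElt (a₁ * x₁) (a₂ * x₂) (a₃ * x₃) (b₁ * u₁) (b₂ * u₂) (b₃ * u₃) =
      a₁⁻¹ * notchedElt x₁ x₂ x₃ u₁ u₂ u₃ := by
  obtain rfl : b₁ = a₃ ^ 2 / a₂ ^ 2 := by rw [eq_div_iff (by positivity), e1]
  obtain rfl : b₂ = a₁ ^ 2 / a₃ ^ 2 := by rw [eq_div_iff (by positivity), e2]
  obtain rfl : b₃ = a₂ ^ 2 / a₁ ^ 2 := by rw [eq_div_iff (by positivity), e3]
  have hl : loopElt (a₁ * x₁) (a₂ * x₂) (a₃ * x₃) (a₁ ^ 2 / a₃ ^ 2 * u₂) (a₂ ^ 2 / a₁ ^ 2 * u₃) =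
      a₂ * a₃⁻¹ * loopElt x₁ x₂ x₃ u₂ u₃ := by
    simp only [loopElt]
    field_simp
  rw [notchedElt, hl, notchedElt]
  field_simp

theorem smul_eq_coe_mul {n m : ℕ} (a : ℂ) (z : RatFun n m) :
    a • z = algebraMap ℂ (RatFun n m) a * z :=
  Algebra.smul_def a z

/-- The weights of a cluster automorphism on the initial seed. -/
theorem clusterAut_weights (φ : clusterAut 𝔹) : ∃ ζ η : Fin 3 → ℂ,
    (∀ k, ζ k ≠ 0) ∧
    (∀ k, fieldAut 𝔹 φ ((initialSeed 𝔹).var (Sum.inl k)) =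
      ζ k • (initialSeed 𝔹).var (Sum.inl k)) ∧
    (∀ k, fieldAut 𝔹 φ ((initialSeed 𝔹).var (Sum.inr k)) =
      η k • (initialSeed 𝔹).var (Sum.inr k)) ∧
    ∀ k, η k * ζ (k + 1) ^ 2 = ζ (k - 1) ^ 2 := by
  choose ζ hζ0 hζ using fun k : Fin 3 =>
    exists_fieldAut_smul φ ((IsSeed.initial (B := 𝔹)).var_mem (Sum.inl k))
  choose η hη0 hη using fun k : Fin 3 =>
    exists_fieldAut_smul φ ((IsSeed.initial (B := 𝔹)).var_mem (Sum.inr k))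
  choose ξ hξ0 hξ using fun k : Fin 3 =>
    exists_fieldAut_smul φ (((IsSeed.initial (B := 𝔹)).mutate _ k).var_mem (Sum.inl k))
  refine ⟨ζ, η, hζ0, hζ, hη, fun k => ?_⟩
  have h := congrArg (fieldAut 𝔹 φ) (initialSeed_exchange k)
  rw [map_mul, map_add, map_mul, map_pow, map_pow, hζ, hζ, hζ, hη, hξ, smul_mul_smul_comm,
    initialSeed_exchange] at h
  have hind := IsSeed.initial.algebraicIndependent oriented_markovPrinMatrix
  open MvPolynomial in
  have h' : aeval (initialSeed 𝔹).var
      (C (ζ k * ξ k) * (X (Sum.inr k) * X (Sum.inl (k + 1)) ^ 2 + X (Sum.inl (k - 1)) ^ 2) -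
        (C (η k) * X (Sum.inr k) * (C (ζ (k + 1)) * X (Sum.inl (k + 1))) ^ 2 +
          (C (ζ (k - 1)) * X (Sum.inl (k - 1))) ^ 2) :
        MvPolynomial (Fin 3 ⊕ Fin 3) ℂ) = 0 := by
    simp only [smul_eq_coe_mul] at h
    simp only [map_sub, map_add, map_mul, map_pow, aeval_X, aeval_C]
    rw [sub_eq_zero, ← map_mul, h]
  have h0 := (map_eq_zero_iff _ hind).1 h'
  -- Setting the frozen variables to zero isolates the second monomial of the exchange numerator;
  -- the all-ones point then gives the first.
  have e1 := congrArg (MvPolynomial.eval (Sum.elim (fun _ => (1 : ℂ)) fun _ => 0)) h0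
  have e2 := congrArg (MvPolynomial.eval (fun _ => (1 : ℂ))) h0
  simp at e1 e2
  linear_combination -e2 + 2 * e1

theorem upperMysteriousPoints_markovPrinMatrix_nonempty : (upperMysteriousPoints 𝔹).Nonempty := by
  obtain ⟨Ψ, hΨ⟩ := exists_slice_algHom
  obtain ⟨p, hp⟩ := exists_point_of_slice Ψ (slice_algHom_regular hΨ)
  refine ⟨p, fun t ht hmem => ?_, fun hst => hst ?_⟩
  · rw [mem_clusterTorus_iff (ht.algebraicIndependent oriented_markovPrinMatrix)
      (var_mem_upper ht)] at hmem
    -- The point annihilates the initial cluster, hence every cluster.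
    refine hmem (Sum.inl 0) (ht.point_eq_zero oriented_markovPrinMatrix
      (fun t ht => var_mem_upper ht) frozen_inv_mem_upperClusterAlgebra p (fun j => ?_) 0)
    rw [hp _ _ (hΨ (Sum.inl j))]
    exact sliceEval_sliceArc j
  · refine (Subgroup.eq_bot_iff_forall _).2 fun φ hφ => ?_
    obtain ⟨ζ, η, hζ0, hζ, hη, he⟩ := clusterAut_weights φ
    have hφN : ∀ k, fieldAut 𝔹 φ (notchedArc k) = (ζ k)⁻¹ • notchedArc k := by
      intro k
      have h : fieldAut 𝔹 φ (notchedArc k) = notchedElt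
          (fieldAut 𝔹 φ ((initialSeed 𝔹).var (Sum.inl k)))
          (fieldAut 𝔹 φ ((initialSeed 𝔹).var (Sum.inl (k + 1))))
          (fieldAut 𝔹 φ ((initialSeed 𝔹).var (Sum.inl (k - 1))))
          (fieldAut 𝔹 φ ((initialSeed 𝔹).var (Sum.inr k)))
          (fieldAut 𝔹 φ ((initialSeed 𝔹).var (Sum.inr (k + 1))))
          (fieldAut 𝔹 φ ((initialSeed 𝔹).var (Sum.inr (k - 1)))) := by
        simp only [notchedArc, notchedElt, loopElt, map_div₀, map_add, map_sub, map_mul, map_pow,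
          map_one]
      have hinj := (algebraMap ℂ (RatFun 3 3)).injective
      have hne : ∀ k, algebraMap ℂ (RatFun 3 3) (ζ k) ≠ 0 := fun k => by simpa using hζ0 k
      have he' : ∀ k, algebraMap ℂ (RatFun 3 3) (η k) * algebraMap ℂ (RatFun 3 3) (ζ (k + 1)) ^ 2 =
          algebraMap ℂ (RatFun 3 3) (ζ (k - 1)) ^ 2 := fun k => by
        rw [← map_pow, ← map_mul, he, map_pow]
      have he2 := he' (k + 1)
      have he3 := he' (k - 1)
      rw [fin_three_add_add, add_sub_cancel_right] at he2
      rw [sub_add_cancel, fin_three_sub_sub] at he3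
      rw [h, hζ, hζ, hζ, hη, hη, hη]
      simp only [smul_eq_coe_mul]
      rw [notchedElt_scale (hne _) (hne _) (hne _) (he' k) he2 he3, map_inv₀]
      rfl
    have hζ1 : ∀ k, ζ k = 1 := by
      intro k
      have h1 : p (upperAction 𝔹 φ ⟨notchedArc k, notchedArc_mem_upper k⟩) =
          p ⟨notchedArc k, notchedArc_mem_upper k⟩ := hφ _
      have h2 : upperAction 𝔹 φ ⟨notchedArc k, notchedArc_mem_upper k⟩ =
          (ζ k)⁻¹ • ⟨notchedArc k, notchedArc_mem_upper k⟩ := Subtype.ext (hφN k)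
      have h3 : p ⟨notchedArc k, notchedArc_mem_upper k⟩ = 1 := by
        rw [hp _ 1 (by rw [slice_algHom_notchedArc hΨ, map_one]), map_one]
      rw [h2, map_smul, h3, smul_eq_mul, mul_one] at h1
      exact inv_eq_one.1 h1
    refine eq_one_of_fieldAut_fixes oriented_markovPrinMatrix IsSeed.initial fun i => ?_
    rcases i with k | k
    · rw [hζ, hζ1, one_smul]
    · have h := he k
      rw [hζ1, hζ1, one_pow, mul_one] at h
      rw [hη, h, one_smul]

end MysteriousPoint

end ClusterAlg

namespace ClusterAlg

open MvPolynomial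

/-! ### The Markov element and the algebra it generates together with the initial cluster. -/

section MarkovElement

local notation "𝔹" => markovMatrix

/-- The Markov element in the cluster of a seed. -/
noncomputable def markovElt (t : Seed 3 0) : RatFun 3 0 :=
  (∑ i, t.var (Sum.inl i) ^ 2) / ∏ i, t.var (Sum.inl i)

theorem sum_fin_three_cyclic {R : Type*} [AddCommMonoid R] (f : Fin 3 → R) (k : Fin 3)
    {s : Fin 3} (hs : s ≠ 0) : ∑ i, f i = f k + f (k + s) + f (k - s) :=
  prod_fin_three_cyclic (R := Multiplicative R) f k hs

theorem IsSeed.markov_exchange {t : Seed 3 0} (ht : IsSeed 𝔹 t) {s : Fin 3}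
    (h : Oriented t.mat s) (k : Fin 3) :
    t.var (Sum.inl k) * (t.mutate k).var (Sum.inl k) =
      t.var (Sum.inl (k + s)) ^ 2 + t.var (Sum.inl (k - s)) ^ 2 := by
  rw [ht.exchange oriented_markovMatrix h k]
  simp [Seed.posCoeff, Seed.negCoeff]

/-- By the exchange relation, the Markov element is `(z_k + z_k') / (z_{k+s} z_{k-s})`, which is
symmetric in the old and the new variable. -/
theorem IsSeed.markovElt_eq {t : Seed 3 0} (ht : IsSeed 𝔹 t) :
    markovElt t = markovElt (initialSeed 𝔹) := by
  induction ht with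
  | initial => rfl
  | mutate t k ht ih =>
    rw [← ih]
    obtain ⟨s, h⟩ := ht.exists_oriented oriented_markovMatrix
    have h0 := fun i => ht.var_ne_zero oriented_markovMatrix i
    have h1 := (ht.mutate t k).var_ne_zero oriented_markovMatrix (Sum.inl k)
    have hex := ht.markov_exchange h k
    rw [markovElt, markovElt, prod_fin_three_cyclic _ k h.1, prod_fin_three_cyclic _ k h.1,
      sum_fin_three_cyclic _ k h.1, sum_fin_three_cyclic _ k h.1,
      t.mutate_var_of_ne k (i := Sum.inl (k + s)) (by simpa using h.1),
      t.mutate_var_of_ne k (i := Sum.inl (k - s)) (by simpa using h.1)]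
    rw [div_eq_div_iff (mul_ne_zero (mul_ne_zero h1 (h0 _)) (h0 _))
      (mul_ne_zero (mul_ne_zero (h0 _) (h0 _)) (h0 _))]
    linear_combination (t.var (Sum.inl (k + s)) * t.var (Sum.inl (k - s)) *
      ((t.mutate k).var (Sum.inl k) - t.var (Sum.inl k))) * hex

theorem markovElt_mem_laurentRing (t : Seed 3 0) : markovElt t ∈ laurentRing t := by
  rw [markovElt, div_eq_mul_inv, ← Finset.prod_inv_distrib]
  exact mul_mem (sum_mem fun i _ => pow_mem (var_mem_laurentRing t _) _)
    (prod_mem fun i _ => var_inv_mem_laurentRing t _)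

theorem markovElt_mem_upper : markovElt (initialSeed 𝔹) ∈ upperClusterAlgebra 𝔹 := by
  simp only [upperClusterAlgebra, Algebra.mem_iInf]
  intro t ht
  rw [← ht.markovElt_eq]
  exact markovElt_mem_laurentRing t

/-- The initial cluster variables. -/
noncomputable def mvar (i : Fin 3) : RatFun 3 0 := (initialSeed 𝔹).var (Sum.inl i)

/-- The flips of the initial cluster variables. -/
noncomputable def mflip (i : Fin 3) : RatFun 3 0 :=
  ((initialSeed 𝔹).mutate i).var (Sum.inl i)

/-- The Markov element. -/
noncomputable def markovM : RatFun 3 0 := markovElt (initialSeed 𝔹)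

theorem mvar_ne_zero (i : Fin 3) : mvar i ≠ 0 :=
  IsSeed.initial.var_ne_zero oriented_markovMatrix _

theorem mvar_mul_mflip (k : Fin 3) :
    mvar k * mflip k = mvar (k + 1) ^ 2 + mvar (k - 1) ^ 2 :=
  IsSeed.initial.markov_exchange oriented_markovMatrix k

theorem markovM_mul (k : Fin 3) :
    mvar (k + 1) * mvar (k - 1) * markovM = mvar k + mflip k := by
  have h0 := mvar_ne_zero
  have h : markovM = (mvar k ^ 2 + mvar (k + 1) ^ 2 + mvar (k - 1) ^ 2) /
      (mvar k * mvar (k + 1) * mvar (k - 1)) := by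
    rw [markovM, markovElt, prod_fin_three_cyclic _ k (by decide : (1 : Fin 3) ≠ 0),
      sum_fin_three_cyclic _ k (by decide : (1 : Fin 3) ≠ 0)]
    rfl
  refine mul_left_cancel₀ (h0 k) ?_
  rw [mul_add, mvar_mul_mflip, h]
  have h1 := h0 k
  have h2 := h0 (k + 1)
  have h3 := h0 (k - 1)
  field_simp
  ring

/-- The parameters of the polynomial ring over which the upper cluster algebra is free of rank
two. -/
noncomputable def markovParams : Fin 3 → RatFun 3 0 := ![mvar 0, mvar 1, markovM]

theorem mvar_two_quadratic :
    mvar 2 ^ 2 - mvar 0 * mvar 1 * markovM * mvar 2 + (mvar 0 ^ 2 + mvar 1 ^ 2) = 0 := by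
  have h1 : mvar 0 * mvar 1 * markovM = mvar 2 + mflip 2 := markovM_mul 2
  have h2 : mvar 2 * mflip 2 = mvar 0 ^ 2 + mvar 1 ^ 2 := mvar_mul_mflip 2
  linear_combination -mvar 2 * h1 - h2

/-- The field is algebraic over these three elements, because the missing variable is a root of the
monic `mvar_two_quadratic`. -/
theorem algebraicIndependent_markovParams : AlgebraicIndependent ℂ markovParams := by
  refine algebraicIndependent_of_isAlgebraic _ (by simp) ?_
  set A := Algebra.adjoin ℂ (Set.range markovParams) with hA
  have hmem : ∀ i, markovParams i ∈ A := fun i => Algebra.subset_adjoin ⟨i, rfl⟩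
  have h2 : IsAlgebraic A (mvar 2) := by
    have h : IsIntegral A (mvar 2) := by
      refine ⟨Polynomial.X ^ 2 - (Polynomial.C (⟨_, hmem 0⟩ * ⟨_, hmem 1⟩ * ⟨_, hmem 2⟩ : A) *
        Polynomial.X - Polynomial.C (⟨_, hmem 0⟩ ^ 2 + ⟨_, hmem 1⟩ ^ 2 : A)), ?_, ?_⟩
      · refine Polynomial.monic_X_pow_sub ?_
        compute_degree
        norm_num
      · rw [← mvar_two_quadratic]
        simp only [Polynomial.eval₂_sub, Polynomial.eval₂_mul, Polynomial.eval₂_C,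
          Polynomial.eval₂_X_pow, Polynomial.eval₂_X]
        change _ - (mvar 0 * mvar 1 * markovM * mvar 2 - (mvar 0 ^ 2 + mvar 1 ^ 2)) = _
        ring
    exact h.isAlgebraic
  intro z
  have hz : z ∈ IntermediateField.adjoin ℂ (Set.range (initialSeed 𝔹).var) := by
    rw [adjoin_initialSeed_eq_top]
    exact IntermediateField.mem_top
  induction hz using IntermediateField.adjoin_induction with
  | mem x hx =>
    obtain ⟨i | i, rfl⟩ := hx
    · fin_cases i
      · exact isAlgebraic_algebraMap (⟨_, hmem 0⟩ : A)
      · exact isAlgebraic_algebraMap (⟨_, hmem 1⟩ : A)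
      · exact h2
    · exact i.elim0
  | algebraMap x =>
    rw [IsScalarTower.algebraMap_apply ℂ A (RatFun 3 0)]
    exact isAlgebraic_algebraMap _
  | add x y _ _ hx hy => exact hx.add hy
  | inv x _ hx => exact hx.inv
  | mul x y _ _ hx hy => exact hx.mul hy

/-- The substitution homomorphism given by an algebraically independent extended cluster. -/
theorem exists_field_algHom {n m : ℕ} {v : Fin n ⊕ Fin m → RatFun n m}
    (hv : AlgebraicIndependent ℂ v) (B : Matrix (Fin n ⊕ Fin m) (Fin n) ℤ) :
    ∃ σ : RatFun n m →ₐ[ℂ] RatFun n m, ∀ i, σ ((initialSeed B).var i) = v i := by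
  refine ⟨IsFractionRing.liftAlgHom (g := aeval v) hv, fun i => ?_⟩
  refine (IsLocalization.lift_eq _ (X i)).trans ?_
  exact aeval_X v i

theorem mvar_two_ne_mflip_two : mvar 2 - mflip 2 ≠ 0 := by
  intro h
  have h2 : mvar 2 * mflip 2 = mvar 0 ^ 2 + mvar 1 ^ 2 := mvar_mul_mflip 2
  have h3 : aeval (initialSeed 𝔹).var (X (Sum.inl 2) ^ 2 - X (Sum.inl 0) ^ 2 - X (Sum.inl 1) ^ 2 :
      MvPolynomial (Fin 3 ⊕ Fin 0) ℂ) = 0 := by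
    simp only [map_sub, map_pow, aeval_X]
    change mvar 2 ^ 2 - mvar 0 ^ 2 - mvar 1 ^ 2 = 0
    linear_combination mvar 2 * h + h2
  have h4 := (map_eq_zero_iff _
    (IsSeed.initial.algebraicIndependent oriented_markovMatrix)).1 h3
  have h5 := congrArg (MvPolynomial.eval (fun _ => (1 : ℂ))) h4
  simp at h5

/-- Mutation at `2` induces an endomorphism of the field that fixes the three parameters and sends
`x₂` to the other root `x₂'` of its quadratic equation. Subtracting the conjugate relation leaves `b
* (x₂ - x₂') = 0`. -/
theorem markov_free {a b : MvPolynomial (Fin 3) ℂ}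
    (h : aeval markovParams a + aeval markovParams b * mvar 2 = 0) : a = 0 ∧ b = 0 := by
  have ht := IsSeed.mutate _ 2 (IsSeed.initial (B := 𝔹))
  obtain ⟨σ, hσ⟩ := exists_field_algHom (ht.algebraicIndependent oriented_markovMatrix) 𝔹
  have h0 : σ (mvar 0) = mvar 0 := (hσ _).trans (Seed.mutate_var_of_ne _ 2 (by simp))
  have h1 : σ (mvar 1) = mvar 1 := (hσ _).trans (Seed.mutate_var_of_ne _ 2 (by simp))
  have h2 : σ (mvar 2) = mflip 2 := hσ _
  have hM : σ markovM = markovM := by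
    refine Eq.trans ?_ ht.markovElt_eq
    simp only [markovM, markovElt, map_div₀, map_sum, map_prod, map_pow, hσ]
  have hfix : ∀ c, σ (aeval markovParams c) = aeval markovParams c := fun c => by
    rw [comp_aeval_apply]
    congr 2
    funext i
    fin_cases i
    exacts [h0, h1, hM]
  have h' := congrArg σ h
  rw [map_add, map_mul, hfix, hfix, h2, map_zero] at h'
  have hb : aeval markovParams b = 0 := by
    refine (mul_eq_zero.1 (?_ : aeval markovParams b * (mvar 2 - mflip 2) = 0)).resolve_right
      mvar_two_ne_mflip_two
    linear_combination h - h'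
  rw [hb, zero_mul, add_zero] at h
  have hinj := algebraicIndependent_markovParams
  exact ⟨(map_eq_zero_iff _ hinj).1 h, (map_eq_zero_iff _ hinj).1 hb⟩

/-- The algebra generated by the initial cluster and the Markov element. -/
noncomputable def markovAlgebra : Subalgebra ℂ (RatFun 3 0) :=
  Algebra.adjoin ℂ (insert markovM (Set.range mvar))

theorem mvar_mem (i : Fin 3) : mvar i ∈ markovAlgebra :=
  Algebra.subset_adjoin (Set.mem_insert_of_mem _ ⟨i, rfl⟩)

theorem markovM_mem : markovM ∈ markovAlgebra :=
  Algebra.subset_adjoin (Set.mem_insert _ _)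

theorem mflip_mem (i : Fin 3) : mflip i ∈ markovAlgebra := by
  rw [eq_sub_of_add_eq' (markovM_mul i).symm]
  exact sub_mem (mul_mem (mul_mem (mvar_mem _) (mvar_mem _)) markovM_mem) (mvar_mem _)

theorem aeval_markovParams_mem (c : MvPolynomial (Fin 3) ℂ) :
    aeval markovParams c ∈ markovAlgebra := by
  induction c using MvPolynomial.induction_on with
  | C a => rw [aeval_C]; exact Subalgebra.algebraMap_mem _ a
  | add p q hp hq => rw [map_add]; exact add_mem hp hq
  | mul_X p i hp =>
    rw [map_mul, aeval_X]
    refine mul_mem hp ?_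
    fin_cases i
    exacts [mvar_mem 0, mvar_mem 1, markovM_mem]

theorem exists_eq_of_mem_markovAlgebra {f : RatFun 3 0} (hf : f ∈ markovAlgebra) :
    ∃ a b : MvPolynomial (Fin 3) ℂ, f = aeval markovParams a + aeval markovParams b * mvar 2 := by
  induction hf using Algebra.adjoin_induction with
  | mem x hx =>
    rcases hx with rfl | ⟨i, rfl⟩
    · exact ⟨X 2, 0, by simp [markovParams]⟩
    · fin_cases i
      · exact ⟨X 0, 0, by simp [markovParams]⟩
      · exact ⟨X 1, 0, by simp [markovParams]⟩
      · exact ⟨0, 1, by simp⟩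
  | algebraMap r => exact ⟨C r, 0, by simp⟩
  | add x y _ _ hx hy =>
    obtain ⟨a, b, rfl⟩ := hx
    obtain ⟨c, d, rfl⟩ := hy
    exact ⟨a + c, b + d, by simp only [map_add]; ring⟩
  | mul x y _ _ hx hy =>
    obtain ⟨a, b, rfl⟩ := hx
    obtain ⟨c, d, rfl⟩ := hy
    refine ⟨a * c - b * d * (X 0 ^ 2 + X 1 ^ 2), a * d + b * c + b * d * (X 0 * X 1 * X 2), ?_⟩
    simp only [map_add, map_mul, map_sub, map_pow, aeval_X]
    change _ = aeval markovParams a * aeval markovParams c - aeval markovParams b *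
      aeval markovParams d * (mvar 0 ^ 2 + mvar 1 ^ 2) + (aeval markovParams a *
      aeval markovParams d + aeval markovParams b * aeval markovParams c +
      aeval markovParams b * aeval markovParams d * (mvar 0 * mvar 1 * markovM)) * mvar 2
    linear_combination (aeval markovParams b * aeval markovParams d) * mvar_two_quadratic

/-- The ideal of denominators of `u` in the Markov algebra. -/
def denomIdeal (u : RatFun 3 0) : Ideal markovAlgebra where
  carrier := {s | u * (s : RatFun 3 0) ∈ markovAlgebra}
  add_mem' := by
    intro a b ha hb
    change u * ((a : RatFun 3 0) + b) ∈ markovAlgebra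
    rw [mul_add]
    exact add_mem ha hb
  zero_mem' := by
    change u * (0 : RatFun 3 0) ∈ markovAlgebra
    rw [mul_zero]
    exact zero_mem _
  smul_mem' := by
    intro c a ha
    change u * ((c : RatFun 3 0) * a) ∈ markovAlgebra
    rw [mul_left_comm]
    exact mul_mem c.2 ha

/-- The Markov algebra is normal enough: denominators without common prime factors can be
cancelled. -/
theorem mem_markovAlgebra_of_forall_prime {u : RatFun 3 0} (D : Set (MvPolynomial (Fin 3) ℂ))
    (hD : ∀ h ∈ D, u * aeval markovParams h ∈ markovAlgebra)
    (hne : ∃ h ∈ D, h ≠ 0)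
    (hgcd : ∀ π : MvPolynomial (Fin 3) ℂ, Prime π → ∃ h ∈ D, ¬π ∣ h) : u ∈ markovAlgebra := by
  choose! a b hab using fun h hh => exists_eq_of_mem_markovAlgebra (hD h hh)
  have hcross : ∀ g ∈ D, ∀ h ∈ D, a g * h = a h * g ∧ b g * h = b h * g := by
    intro g hg h hh
    have := markov_free (a := a g * h - a h * g) (b := b g * h - b h * g) (by
      simp only [map_sub, map_mul]
      linear_combination (-aeval markovParams h) * hab g hg + aeval markovParams g * hab h hh)
    exact ⟨sub_eq_zero.1 this.1, sub_eq_zero.1 this.2⟩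
  obtain ⟨g, hg, hg0⟩ := hne
  let K := FractionRing (MvPolynomial (Fin 3) ℂ)
  have hgK : algebraMap (MvPolynomial (Fin 3) ℂ) K g ≠ 0 := by
    rwa [Ne, FaithfulSMul.algebraMap_eq_zero_iff]
  -- The fraction `c h / h` is the same for all `h ∈ D`, and every prime is avoided by some `h`, so
  -- it is a polynomial.
  have key : ∀ c : MvPolynomial (Fin 3) ℂ → MvPolynomial (Fin 3) ℂ,
      (∀ h ∈ D, c g * h = c h * g) → ∃ r, c g = r * g := by
    intro c hc
    obtain ⟨r, hr⟩ := exists_algebraMap_eq_of_forall_prime (P := MvPolynomial (Fin 3) ℂ) (K := K)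
      (algebraMap _ K (c g) / algebraMap _ K g) (fun π hπ => by
        obtain ⟨h, hh, hπh⟩ := hgcd π hπ
        refine ⟨c h, h, hπh, ?_⟩
        rw [div_mul_eq_mul_div, div_eq_iff hgK, ← map_mul, ← map_mul, hc h hh])
    refine ⟨r, IsFractionRing.injective (MvPolynomial (Fin 3) ℂ) K ?_⟩
    rw [map_mul, ← hr, div_mul_cancel₀ _ hgK]
  obtain ⟨r, hr⟩ := key a fun h hh => (hcross g hg h hh).1
  obtain ⟨s, hs⟩ := key b fun h hh => (hcross g hg h hh).2
  have hu : u = aeval markovParams r + aeval markovParams s * mvar 2 := by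
    have hg' : aeval markovParams g ≠ 0 := fun h =>
      hg0 ((map_eq_zero_iff _ algebraicIndependent_markovParams).1 h)
    refine mul_right_cancel₀ hg' ?_
    rw [hab g hg, hr, hs, map_mul, map_mul]
    ring
  rw [hu]
  exact add_mem (aeval_markovParams_mem _) (mul_mem (aeval_markovParams_mem _) (mvar_mem _))

theorem exists_pow_mem_denomIdeal {t : Seed 3 0} (ht : IsSeed 𝔹 t)
    (hS : ∀ i, t.var (Sum.inl i) ∈ markovAlgebra) {u : RatFun 3 0}
    (hu : u ∈ upperClusterAlgebra 𝔹) :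
    ∃ N : ℕ, (⟨_, hS 0⟩ * ⟨_, hS 1⟩ * ⟨_, hS 2⟩ : markovAlgebra) ^ N ∈ denomIdeal u := by
  obtain ⟨N, g, hg⟩ := exists_mul_prod_pow_eq_aeval
    (fun i => ht.var_ne_zero oriented_markovMatrix i)
    (upperClusterAlgebra_le_laurentRing ht hu)
  refine ⟨N, ?_⟩
  change u * (t.var (Sum.inl 0) * t.var (Sum.inl 1) * t.var (Sum.inl 2)) ^ N ∈ markovAlgebra
  rw [Fintype.prod_sum_type, Fin.prod_univ_three, Finset.univ_eq_empty, Finset.prod_empty,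
    mul_one] at hg
  rw [hg]
  have hS' : ∀ i, t.var i ∈ markovAlgebra := by
    rintro (i | i)
    exacts [hS i, i.elim0]
  rw [← coe_aeval_subtype hS']
  exact Subtype.property _

end MarkovElement

end ClusterAlg

namespace ClusterAlg

open MvPolynomial

/-! ### The coefficient-free upper cluster algebra: generators and absence of mysterious points. -/

section MarkovUpper

local notation "𝔹" => markovMatrix

theorem mutate_initialSeed_var_of_ne {k j : Fin 3} (h : j ≠ k) :
    ((initialSeed 𝔹).mutate k).var (Sum.inl j) = mvar j :=
  Seed.mutate_var_of_ne _ k (by simpa using h)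

theorem mutate_initialSeed_var_mem (k j : Fin 3) :
    ((initialSeed 𝔹).mutate k).var (Sum.inl j) ∈ markovAlgebra := by
  by_cases h : j = k
  · subst h
    exact mflip_mem j
  · rw [mutate_initialSeed_var_of_ne h]
    exact mvar_mem j

/-- A cofactor `c`, in practice a conjugate, moves a denominator from the Markov algebra into the
polynomial ring of parameters. -/
theorem mul_aeval_pow_mem_markovAlgebra {u : RatFun 3 0} {s : markovAlgebra} {N : ℕ}
    (hs : s ^ N ∈ denomIdeal u) {c : RatFun 3 0} (hc : c ∈ markovAlgebra)
    {h : MvPolynomial (Fin 3) ℂ} (hh : aeval markovParams h = s * c) :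
    u * aeval markovParams (h ^ N) ∈ markovAlgebra := by
  rw [map_pow, hh, mul_pow, ← mul_assoc]
  exact mul_mem hs (pow_mem hc N)

theorem aeval_markovParams_X_zero : aeval markovParams (X 0 : MvPolynomial (Fin 3) ℂ) = mvar 0 :=
  aeval_X _ _

theorem aeval_markovParams_X_one : aeval markovParams (X 1 : MvPolynomial (Fin 3) ℂ) = mvar 1 :=
  aeval_X _ _

theorem aeval_markovParams_X_two : aeval markovParams (X 2 : MvPolynomial (Fin 3) ℂ) = markovM :=
  aeval_X _ _

theorem not_X_dvd_of_eval_ne_zero {i : Fin 3} {q : MvPolynomial (Fin 3) ℂ} (v : Fin 3 → ℂ)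
    (hv : v i = 0) (hq : MvPolynomial.eval v q ≠ 0) : ¬X i ∣ q := by
  rintro ⟨r, rfl⟩
  simp [hv] at hq

theorem upperClusterAlgebra_le_markovAlgebra : upperClusterAlgebra 𝔹 ≤ markovAlgebra := by
  intro u hu
  have hmut := fun k => exists_pow_mem_denomIdeal (IsSeed.mutate _ k IsSeed.initial)
    (mutate_initialSeed_var_mem k) hu
  obtain ⟨N, hN⟩ := exists_pow_mem_denomIdeal IsSeed.initial mvar_mem hu
  obtain ⟨N₀, hN₀⟩ := hmut 0
  obtain ⟨N₁, hN₁⟩ := hmut 1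
  obtain ⟨N₂, hN₂⟩ := hmut 2
  have q₂ : mvar 2 * mflip 2 = mvar 0 ^ 2 + mvar 1 ^ 2 := mvar_mul_mflip 2
  have m₀ : mvar 1 * mvar 2 * markovM = mvar 0 + mflip 0 := markovM_mul 0
  have m₁ : mvar 2 * mvar 0 * markovM = mvar 1 + mflip 1 := markovM_mul 1
  have m₂ : mvar 0 * mvar 1 * markovM = mvar 2 + mflip 2 := markovM_mul 2
  have w : ∀ k j : Fin 3, j ≠ k → ((initialSeed 𝔹).mutate k).var (Sum.inl j) = mvar j :=
    fun k j h => mutate_initialSeed_var_of_ne h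
  have w' : ∀ k : Fin 3, ((initialSeed 𝔹).mutate k).var (Sum.inl k) = mflip k := fun _ => rfl
  have hM := markovM_mem
  have hv := mvar_mem
  have hE := mflip_mem
  -- `h₁`, `h₂`, `h₃` are the cluster products of the initial seed and of its mutations at `0` and
  -- `1`, with each factor outside the parameter ring multiplied by its conjugate under `x₂ ↔ x₂'`.
  -- `h₄` is the sum of the products for the initial seed and its mutation at `2`, that is `x₀x₁(x₂
  -- + x₂') = x₀²x₁²M`.
  let h₁ : MvPolynomial (Fin 3) ℂ := X 0 * X 1 * (X 0 ^ 2 + X 1 ^ 2)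
  let h₂ : MvPolynomial (Fin 3) ℂ := (X 1 ^ 4 * X 2 ^ 2 + X 0 ^ 2) * X 1 * (X 0 ^ 2 + X 1 ^ 2)
  let h₃ : MvPolynomial (Fin 3) ℂ := (X 0 ^ 4 * X 2 ^ 2 + X 1 ^ 2) * X 0 * (X 0 ^ 2 + X 1 ^ 2)
  let h₄ : MvPolynomial (Fin 3) ℂ := X 0 ^ 2 * X 1 ^ 2 * X 2
  have d₁ : u * aeval markovParams (h₁ ^ N) ∈ markovAlgebra := by
    refine mul_aeval_pow_mem_markovAlgebra hN (hE 2) ?_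
    simp only [h₁, map_mul, map_add, map_pow, aeval_markovParams_X_zero,
      aeval_markovParams_X_one]
    change _ = mvar 0 * mvar 1 * mvar 2 * mflip 2
    linear_combination -(mvar 0 * mvar 1) * q₂
  have d₂ : u * aeval markovParams (h₂ ^ N₀) ∈ markovAlgebra := by
    refine mul_aeval_pow_mem_markovAlgebra hN₀
      (mul_mem (sub_mem (mul_mem (mul_mem (hv 1) (hE 2)) hM) (hv 0)) (hE 2)) ?_
    simp only [h₂, map_mul, map_add, map_pow, aeval_markovParams_X_zero,
      aeval_markovParams_X_one, aeval_markovParams_X_two, MulMemClass.coe_mul, w',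
      w 0 1 (by decide), w 0 2 (by decide)]
    have e : mflip 0 = mvar 1 * mvar 2 * markovM - mvar 0 := by linear_combination -m₀
    have e' : mflip 2 = mvar 0 * mvar 1 * markovM - mvar 2 := by linear_combination -m₂
    have n : mflip 0 * (mvar 1 * mflip 2 * markovM - mvar 0) =
        mvar 1 ^ 4 * markovM ^ 2 + mvar 0 ^ 2 := by
      rw [e]
      linear_combination (mvar 1 ^ 2 * markovM ^ 2) * q₂ + (mvar 0 * mvar 1 * markovM) * m₂
    linear_combination (-(mvar 1 * (mvar 2 * mflip 2))) * n -
      ((mvar 1 ^ 4 * markovM ^ 2 + mvar 0 ^ 2) * mvar 1) * q₂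
  have d₃ : u * aeval markovParams (h₃ ^ N₁) ∈ markovAlgebra := by
    refine mul_aeval_pow_mem_markovAlgebra hN₁
      (mul_mem (sub_mem (mul_mem (mul_mem (hv 0) (hE 2)) hM) (hv 1)) (hE 2)) ?_
    simp only [h₃, map_mul, map_add, map_pow, aeval_markovParams_X_zero,
      aeval_markovParams_X_one, aeval_markovParams_X_two, MulMemClass.coe_mul, w',
      w 1 0 (by decide), w 1 2 (by decide)]
    have e : mflip 1 = mvar 2 * mvar 0 * markovM - mvar 1 := by linear_combination -m₁
    have n : mflip 1 * (mvar 0 * mflip 2 * markovM - mvar 1) =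
        mvar 0 ^ 4 * markovM ^ 2 + mvar 1 ^ 2 := by
      rw [e]
      linear_combination (mvar 0 ^ 2 * markovM ^ 2) * q₂ + (mvar 0 * mvar 1 * markovM) * m₂
    linear_combination (-(mvar 0 * (mvar 2 * mflip 2))) * n -
      ((mvar 0 ^ 4 * markovM ^ 2 + mvar 1 ^ 2) * mvar 0) * q₂
  have d₄ : u * aeval markovParams (h₄ ^ (N + N₂)) ∈ markovAlgebra := by
    refine mul_aeval_pow_mem_markovAlgebra
      -- A power of each summand lies in the ideal of denominators, hence so does a power of the
      -- sum.
      ((denomIdeal u).add_pow_mem_of_pow_mem_of_le hN hN₂ (Nat.le_succ _))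
      (one_mem _) ?_
    simp only [h₄, map_mul, map_pow, aeval_markovParams_X_zero, aeval_markovParams_X_one,
      aeval_markovParams_X_two, MulMemClass.coe_mul, AddMemClass.coe_add, w',
      w 2 0 (by decide), w 2 1 (by decide)]
    change _ = (mvar 0 * mvar 1 * mvar 2 + _) * 1
    linear_combination (mvar 0 * mvar 1) * m₂
  have hX : ∀ {π : MvPolynomial (Fin 3) ℂ} {i : Fin 3} {q}, Prime π → π ∣ X i → π ∣ q →
      X i ∣ q := fun hπ hi hq =>
    ((hπ.dvd_prime_iff_associated X_prime).1 hi).dvd_iff_dvd_left.1 hq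
  refine mem_markovAlgebra_of_forall_prime {h₁ ^ N, h₂ ^ N₀, h₃ ^ N₁, h₄ ^ (N + N₂)} ?_ ?_ ?_
  · rintro h (rfl | rfl | rfl | rfl)
    exacts [d₁, d₂, d₃, d₄]
  · refine ⟨_, Or.inl rfl, fun h => ?_⟩
    have := congrArg (MvPolynomial.eval fun _ => (1 : ℂ)) h
    norm_num [h₁] at this
  · intro π hπ
    by_contra! hall
    have p₁ := hπ.dvd_of_dvd_pow (hall _ (Or.inl rfl))
    have p₂ := hπ.dvd_of_dvd_pow (hall _ (Or.inr (Or.inl rfl)))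
    have p₃ := hπ.dvd_of_dvd_pow (hall _ (Or.inr (Or.inr (Or.inl rfl))))
    have p₄ := hπ.dvd_of_dvd_pow (hall _ (Or.inr (Or.inr (Or.inr rfl))))
    -- A common prime divides `h₁`. If it is `x₀` or `x₁` up to a unit, `h₂` or `h₃` excludes it; if
    -- it divides `x₀² + x₁²`, then `h₄` does.
    rcases hπ.dvd_or_dvd p₁ with h | h
    · rcases hπ.dvd_or_dvd h with h | h
      · exact not_X_dvd_of_eval_ne_zero ![0, 1, 1] rfl (by simp [h₂]) (hX hπ h p₂)
      · exact not_X_dvd_of_eval_ne_zero ![1, 0, 1] rfl (by simp [h₃]) (hX hπ h p₃)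
    · rcases hπ.dvd_or_dvd p₄ with h' | h'
      · rcases hπ.dvd_or_dvd h' with h' | h'
        · exact not_X_dvd_of_eval_ne_zero ![0, 1, 1] rfl (by simp)
            (hX hπ (hπ.dvd_of_dvd_pow h') h)
        · exact not_X_dvd_of_eval_ne_zero ![1, 0, 1] rfl (by simp)
            (hX hπ (hπ.dvd_of_dvd_pow h') h)
      · exact not_X_dvd_of_eval_ne_zero ![1, 1, 0] rfl (by norm_num) (hX hπ h' h)

theorem mvar_mem_upper (i : Fin 3) : mvar i ∈ upperClusterAlgebra 𝔹 :=
  IsSeed.initial.var_mem_upperClusterAlgebra oriented_markovMatrix _ _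

/-- It suffices to test the generators `x_i` and `M`; the weight of `M` is the product of the signs.
-/
theorem signAut_mem_pointStabilizer {ε : Fin 3 → ℂ} (hε : ∀ i, ε i * ε i = 1)
    {p : Points (upperClusterAlgebra 𝔹)}
    (hp : ∀ i, p ⟨mvar i, mvar_mem_upper i⟩ = 0 ∨ ε i = 1)
    (hM : p ⟨markovM, markovElt_mem_upper⟩ = 0 ∨ ε 0 * ε 1 * ε 2 = 1) :
    signAut oriented_markovMatrix ε hε ∈ pointStabilizer (upperAction 𝔹) p := by
  have hle : markovAlgebra ≤ upperClusterAlgebra 𝔹 := by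
    refine Algebra.adjoin_le (Set.insert_subset markovElt_mem_upper ?_)
    rintro _ ⟨i, rfl⟩
    exact mvar_mem_upper i
  set σ := signAut oriented_markovMatrix ε hε
  have hσ : ∀ i, fieldAut 𝔹 σ (mvar i) = ε i • mvar i := fun i => by
    rw [fieldAut_signAut]
    exact IsSeed.initial.fieldSign_var oriented_markovMatrix hε (Sum.inl i)
  have hσM : fieldAut 𝔹 σ markovM = (ε 0 * ε 1 * ε 2) • markovM := by
    have e : markovM = (mvar 0 ^ 2 + mvar 1 ^ 2 + mvar 2 ^ 2) / (mvar 0 * mvar 1 * mvar 2) := by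
      rw [markovM, markovElt, Fin.sum_univ_three, Fin.prod_univ_three]
      rfl
    have hsq : ∀ i, (ε i • mvar i) ^ 2 = mvar i ^ 2 := fun i => by
      rw [smul_pow, sq (ε i), hε, one_smul]
    have hinv : (ε 0 * ε 1 * ε 2)⁻¹ = ε 0 * ε 1 * ε 2 := by
      refine inv_eq_of_mul_eq_one_left ?_
      linear_combination (ε 1 * ε 1 * (ε 2 * ε 2)) * hε 0 + (ε 2 * ε 2) * hε 1 + hε 2
    rw [e]
    simp only [map_div₀, map_add, map_mul, map_pow, hσ, hsq, smul_mul_smul_comm]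
    rw [Algebra.smul_def, Algebra.smul_def, div_eq_mul_inv, mul_inv, ← map_inv₀, hinv,
      mul_left_comm, ← div_eq_mul_inv]
  have hsm : ∀ (z : RatFun 3 0) (hz : z ∈ upperClusterAlgebra 𝔹) (c : ℂ),
      fieldAut 𝔹 σ z = c • z → (p ⟨z, hz⟩ = 0 ∨ c = 1) →
      p (upperAction 𝔹 σ ⟨z, hz⟩) = p ⟨z, hz⟩ := by
    intro z hz c hc h
    have h1 : upperAction 𝔹 σ ⟨z, hz⟩ = c • ⟨z, hz⟩ :=
      Subtype.ext ((isRestrictedAction_upperAction σ ⟨z, hz⟩).trans hc)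
    rw [h1, map_smul]
    rcases h with h | h
    · rw [h, smul_zero]
    · rw [h, one_smul]
  suffices h : ∀ z (hz : z ∈ markovAlgebra),
      p (upperAction 𝔹 σ ⟨z, hle hz⟩) = p ⟨z, hle hz⟩ from
    fun r => h r (upperClusterAlgebra_le_markovAlgebra r.2)
  intro z hz
  induction hz using Algebra.adjoin_induction with
  | mem z hz =>
    rcases hz with rfl | ⟨i, rfl⟩
    · exact hsm _ _ _ hσM hM
    · exact hsm _ _ _ (hσ i) (hp i)
  | algebraMap a =>
    exact hsm _ _ 1 (by rw [AlgEquiv.commutes, one_smul]) (Or.inr rfl)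
  | add x y hx hy h1 h2 =>
    change p (upperAction 𝔹 σ (⟨x, hle hx⟩ + ⟨y, hle hy⟩)) = p (⟨x, hle hx⟩ + ⟨y, hle hy⟩)
    rw [map_add, map_add, map_add, h1, h2]
  | mul x y hx hy h1 h2 =>
    change p (upperAction 𝔹 σ (⟨x, hle hx⟩ * ⟨y, hle hy⟩)) = p (⟨x, hle hx⟩ * ⟨y, hle hy⟩)
    rw [map_mul, map_mul, map_mul, h1, h2]

theorem upperHasNoMysteriousPoints_markovMatrix : UpperHasNoMysteriousPoints 𝔹 := by
  refine Set.Subset.antisymm (stabilizerLocus_subset_deepLocus oriented_markovMatrix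
    (fun t ht i => IsSeed.var_mem_upperClusterAlgebra oriented_markovMatrix t ht i)
    isRestrictedAction_upperAction) fun p hp => ?_
  suffices h : ∃ (ε : Fin 3 → ℂ) (i : Fin 3), (∀ i, ε i * ε i = 1) ∧ ε i ≠ 1 ∧
      (∀ i, p ⟨mvar i, mvar_mem_upper i⟩ = 0 ∨ ε i = 1) ∧
      (p ⟨markovM, markovElt_mem_upper⟩ = 0 ∨ ε 0 * ε 1 * ε 2 = 1) by
    obtain ⟨ε, i, hε, hi, hv, hM⟩ := h
    exact fun hbot => signAut_ne_one oriented_markovMatrix hε hi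
      ((Subgroup.eq_bot_iff_forall _).1 hbot _ (signAut_mem_pointStabilizer hε hv hM))
  rcases deepLocus_dichotomy oriented_markovMatrix
    (IsSeed.var_mem_upperClusterAlgebra oriented_markovMatrix)
    frozen_inv_mem_upperClusterAlgebra hp with h | ⟨i, h⟩
  -- All `x_i` vanish but `M` need not, so an even number of signs is taken.
  · refine ⟨![-1, -1, 1], 0, fun i => by fin_cases i <;> simp, ?_,
      fun i => Or.inl (h _ IsSeed.initial i), Or.inr (by simp)⟩
    change (-1 : ℂ) ≠ 1
    norm_num
  -- A single sign negates `M`; this is harmless because `M` vanishes at the point: `x_i` and its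
  -- flip vanish while the other two variables do not.
  · refine ⟨singleSign i, i, singleSign_mul_self i,
      by simp only [singleSign, if_true]; norm_num, fun j => ?_, Or.inl ?_⟩
    · by_cases hj : j = i
      · subst hj
        exact Or.inl (h _ IsSeed.initial).1
      · exact Or.inr (if_neg hj)
    · have hflip : mflip i ∈ upperClusterAlgebra 𝔹 :=
        (IsSeed.mutate _ i IsSeed.initial).var_mem_upperClusterAlgebra oriented_markovMatrix _ _
      have h0 : p ⟨mvar i, mvar_mem_upper i⟩ = 0 := (h _ IsSeed.initial).1
      have h0' : p ⟨mflip i, hflip⟩ = 0 := (h _ (IsSeed.mutate _ i IsSeed.initial)).1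
      have h1 : p ⟨mvar (i + 1), mvar_mem_upper _⟩ ≠ 0 :=
        (h _ IsSeed.initial).2 _ (fin_three_add_ne (by decide) i)
      have h2 : p ⟨mvar (i - 1), mvar_mem_upper _⟩ ≠ 0 :=
        (h _ IsSeed.initial).2 _ (fin_three_sub_ne (by decide) i)
      have hrel : (⟨mvar (i + 1), mvar_mem_upper _⟩ * ⟨mvar (i - 1), mvar_mem_upper _⟩ *
          ⟨markovM, markovElt_mem_upper⟩ : upperClusterAlgebra 𝔹) =
          ⟨mvar i, mvar_mem_upper i⟩ + ⟨mflip i, hflip⟩ := Subtype.ext (markovM_mul i)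
      have := congrArg p hrel
      rw [map_mul, map_mul, map_add, h0, h0', add_zero] at this
      exact (mul_eq_zero.1 this).resolve_left (mul_ne_zero h1 h2)

end MarkovUpper

end ClusterAlg

theorem proposition3p16 :
    ClusterAlg.ClusterHasNoMysteriousPoints ClusterAlg.markovPrinMatrix ∧
    (ClusterAlg.upperMysteriousPoints ClusterAlg.markovPrinMatrix).Nonempty ∧
    ClusterAlg.ClusterHasNoMysteriousPoints ClusterAlg.markovMatrix ∧
    ClusterAlg.UpperHasNoMysteriousPoints ClusterAlg.markovMatrix :=
  ⟨ClusterAlg.clusterHasNoMysteriousPoints_of_oriented ClusterAlg.oriented_markovPrinMatrix,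
    ClusterAlg.upperMysteriousPoints_markovPrinMatrix_nonempty,
    ClusterAlg.clusterHasNoMysteriousPoints_of_oriented ClusterAlg.oriented_markovMatrix,
    ClusterAlg.upperHasNoMysteriousPoints_markovMatrix⟩
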